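/- A graph $\Gamma$ is $n$-existentially closed ($n$-e.c.), $n\ge 1$, if for all disjoint sets $A,B$ of vertices with $|A\cup B|=n$ (one of them may be empty) there is a vertex $z\notin A\cup B$ adjacent to every vertex of $A$ and to no vertex of $B$. The existential closure number $\Xi(\Gamma)$ is the largest integer $n\ge 0$ such that $\Gamma$ is $m$-e.c. for every $1\le m\le n$ (so $\Xi(\Gamma)=0$ if $\Gamma$ is not $1$-e.c.; put $\Xi(\Gamma)=\infty$ if there is no largest such $n$). The block intersection graph $\Gamma_{\mathscr D}$ of a design $\mathscr D=(V,\mathcal B)$ has the blocks as vertices, two distinct blocks being adjacent if and only if they have non-empty intersection. Let $\lambda\ge 1$ and let $\mathscr D=(V,\mathcal B)$ be a simple $\lambda$-fold quadruple system of order $v$, i.e. a $3$-$(v,4,\lambda)$ design without repeated blocks: $|V|=v$, every block is a $4$-subset of $V$, and every $3$-subset of $V$ is contained in exactly $\lambda$ blocks. Then $\Xi(\Gamma_{\mathscr D})=2$ whenever $v\ge 16$. In particular, if $\mathscr D$ is a Steiner quadruple system $\mathrm{SQS}(v)$ (i.e. $\lambda=1$), then $\Xi(\Gamma_{\mathscr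 D})=2$ if and only if $v\ge 16$. -/

import Mathlib

/-- A graph is `n`-existentially closed if for any two disjoint sets `A`, `B` of vertices with
`|A ∪ B| = n` there is a vertex outside `A ∪ B` adjacent to every vertex of `A` and to no
vertex of `B`. -/
def IsExistentiallyClosed {W : Type*} [DecidableEq W] (G : SimpleGraph W) (n : ℕ) : Prop :=
  ∀ A B : Finset W, Disjoint A B → (A ∪ B).card = n →
    ∃ z : W, z ∉ A ∪ B ∧ (∀ a ∈ A, G.Adj z a) ∧ (∀ b ∈ B, ¬ G.Adj z b)

/-- The existential closure number: the largest `n` such that the graph is `m`-existentially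
closed for all `1 ≤ m ≤ n` (so it is `0` if the graph is not `1`-existentially closed). The value
`⊤` occurs only if there is no largest such `n`. Requiring all `m ≤ n` matters only because
`n`-existential closure is vacuous when there are fewer than `n` vertices. -/
noncomputable def existentialClosureNumber {W : Type*} [DecidableEq W] (G : SimpleGraph W) : ℕ∞ :=
  sSup {x : ℕ∞ | ∃ n : ℕ, x = (n : ℕ∞) ∧ ∀ m : ℕ, 1 ≤ m → m ≤ n → IsExistentiallyClosed G m}

/-- The family `𝓑` of pairwise distinct subsets of `V` is the block set of a simple
`t`-`(v, k, lam)` design on the point set `V`. -/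
structure IsSimpleDesign {V : Type*} [Fintype V] [DecidableEq V] (t v k lam : ℕ)
    (𝓑 : Finset (Finset V)) : Prop where
  card_points : Fintype.card V = v
  card_block : ∀ B ∈ 𝓑, B.card = k
  card_blocks_through : ∀ T : Finset V, T.card = t → (𝓑.filter fun B => T ⊆ B).card = lam

/-- A Steiner quadruple system of order `v` is a `3`-`(v, 4, 1)` design; with index `1` it is
automatically simple. -/
def IsSteinerQuadrupleSystem {V : Type*} [Fintype V] [DecidableEq V] (v : ℕ)
    (𝓑 : Finset (Finset V)) : Prop :=
  IsSimpleDesign 3 v 4 1 𝓑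

/-- The block intersection graph: the vertices are the blocks, and two distinct blocks are
adjacent if they have a point in common. -/
def blockIntersectionGraph {V : Type*} [DecidableEq V] (𝓑 : Finset (Finset V)) :
    SimpleGraph {B : Finset V // B ∈ 𝓑} where
  Adj B C := B ≠ C ∧ (B.1 ∩ C.1).Nonempty
  symm := ⟨fun B C h => ⟨h.1.symm, by rw [Finset.inter_comm]; exact h.2⟩⟩
  loopless := ⟨fun _ h => h.1 rfl⟩

/-! Double counting shows that a point set of size 3, 2, 1 or 0 lies in a number of blocks that
depends only on its size, `v` and `lam`. By inclusion-exclusion, the number of blocks avoiding a set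
`S` is then determined by `v`, `lam`, `|S|` and the number of blocks inside `S`
(`card_disjoint_eq`). For `|S| = 8` and `v = 16 + u` it equals `lam * (u^3 + 13 * u^2 + 82 * u) /
24` plus the number of blocks inside `S`. Two blocks lie in a common 8-set, so some block misses
both. At `v = 16` the polynomial vanishes and the blocks inside `S` are all that remains. Blocks
meeting both of two given blocks, or just one of them, come from cruder counts through a pair or a
point. This gives 2-existential closure.

Closure fails at 3 for a local reason: split a block into two pairs and take another block through
each pair. Whatever meets the first block meets one of the other two.

For the converse with `lam = 1`, divisibility leaves the orders below 3 and 4, 8, 10, 14. Below 3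
there are no blocks, closure is vacuous and the closure number is infinite; at order 4 there is one
block. At 8 and 10 two suitable blocks leave fewer than four points uncovered, so no block misses
both. At 14 an 8-set is avoided by five blocks fewer than it contains, so counting alone does not
decide; what is needed is a disjoint pair of blocks that every block meets.

That pair is found by a verified exhaustive search. The blocks through one point form a Steiner
triple system on the other thirteen, and branching with relabelling reduces these to two systems
(`checkTree_branchings`). For each of the two, the quadruple systems extending it are split
according to the orbits, under symmetries of the triple system, that their further blocks meet; each
part is searched separately (`resolved_cyclic`, `resolved_acyclic`). Soundness rests on one
invariant, `Admits`: no step discards a block of a system that is still possible. How the next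
triple is chosen affects only the running time. -/

/-! ### Counting the blocks that contain or avoid a set of points. -/

section Counting

variable {V : Type*} [DecidableEq V]

/-- The number of blocks containing `S`. -/
def blocksThrough (𝓑 : Finset (Finset V)) (S : Finset V) : ℕ := (𝓑.filter fun B => S ⊆ B).card

/-- Both sides count the pairs `(T, B)` with `T` a `j`-subset of `S ∩ B`. -/
theorem sum_powersetCard_blocksThrough (𝓑 : Finset (Finset V)) (S : Finset V) (j : ℕ) :
    ∑ T ∈ S.powersetCard j, blocksThrough 𝓑 T = ∑ B ∈ 𝓑, (S ∩ B).card.choose j := by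
  simp_rw [blocksThrough, Finset.card_filter]
  rw [Finset.sum_comm]
  apply Finset.sum_congr rfl
  intro B _
  rw [← Finset.card_filter, ← Finset.card_powersetCard]
  congr 1
  ext T
  simp only [Finset.mem_filter, Finset.mem_powersetCard, Finset.subset_inter_iff]
  tauto

/-- Inclusion-exclusion for the blocks avoiding a set of points, for block size four. -/
theorem card_blocks_disjoint {𝓑 : Finset (Finset V)} (hk : ∀ B ∈ 𝓑, B.card = 4) (S : Finset V) :
    (((𝓑.filter fun B => Disjoint S B).card : ℕ) : ℤ)
      = ∑ j ∈ Finset.range 5, (-1) ^ j * ∑ T ∈ S.powersetCard j, (blocksThrough 𝓑 T : ℤ) := by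
  have h1 : ∀ j ∈ Finset.range 5, (-1 : ℤ) ^ j * ∑ T ∈ S.powersetCard j, (blocksThrough 𝓑 T : ℤ)
      = ∑ B ∈ 𝓑, (-1) ^ j * ((S ∩ B).card.choose j : ℤ) := by
    intro j _
    rw [← Finset.mul_sum]
    congr 1
    exact_mod_cast sum_powersetCard_blocksThrough 𝓑 S j
  rw [Finset.sum_congr rfl h1, Finset.sum_comm, Finset.card_filter]
  push_cast
  apply Finset.sum_congr rfl
  intro B hB
  have hle : (S ∩ B).card ≤ 4 := (Finset.card_le_card Finset.inter_subset_right).trans (hk B hB).le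
  simp only [Finset.disjoint_iff_inter_eq_empty, ← Finset.card_eq_zero]
  generalize (S ∩ B).card = n at hle
  -- The alternating sum of the binomials `n.choose j` is 1 for `n = 0` and 0 otherwise; stopping at
  -- `j = 4` loses nothing because `n ≤ 4`.
  interval_cases n <;> simp [Finset.sum_range_succ, Nat.choose]

variable [Fintype V]

/-- Count the pairs `(w, B)` with `S ⊆ B` and `w ∈ B \ S` in two ways. Descending from triples, this
yields the number of blocks through pairs, points and the empty set; those counts are stated
multiplied out, so no divisibility has to be known. -/
theorem sum_blocksThrough_insert {𝓑 : Finset (Finset V)} {k : ℕ} (hk : ∀ B ∈ 𝓑, B.card = k)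
    (S : Finset V) :
    ∑ w ∈ Finset.univ \ S, blocksThrough 𝓑 (insert w S) = blocksThrough 𝓑 S * (k - S.card) := by
  have h1 : ∀ w ∈ Finset.univ \ S, blocksThrough 𝓑 (insert w S)
      = ∑ B ∈ 𝓑.filter (fun B => S ⊆ B), if w ∈ B then 1 else 0 := by
    intro w _
    rw [blocksThrough, ← Finset.card_filter, Finset.filter_filter]
    congr 1
    apply Finset.filter_congr
    intro B _
    rw [Finset.insert_subset_iff, and_comm]
  rw [Finset.sum_congr rfl h1, Finset.sum_comm, blocksThrough, Finset.card_eq_sum_ones,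
    Finset.sum_mul]
  apply Finset.sum_congr rfl
  intro B hB
  rw [Finset.mem_filter] at hB
  rw [← Finset.card_filter, one_mul, ← hk B hB.1, ← Finset.card_sdiff_of_subset hB.2]
  congr 1
  ext w
  simp [and_comm]

variable {v lam : ℕ} {𝓑 : Finset (Finset V)}

namespace IsSimpleDesign

theorem blocksThrough_triple (h : IsSimpleDesign 3 v 4 lam 𝓑) {T : Finset V} (hT : T.card = 3) :
    blocksThrough 𝓑 T = lam := h.card_blocks_through T hT

theorem blocksThrough_insert (h : IsSimpleDesign 3 v 4 lam 𝓑) {S : Finset V} {r : ℕ}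
    (hr : ∀ w ∉ S, blocksThrough 𝓑 (insert w S) = r) :
    (v - S.card) * r = blocksThrough 𝓑 S * (4 - S.card) := by
  rw [← sum_blocksThrough_insert h.card_block S,
    Finset.sum_congr rfl (fun w hw => hr w (by simpa using hw)), Finset.sum_const, smul_eq_mul,
    ← h.card_points, ← Finset.card_univ, Finset.card_sdiff_of_subset (Finset.subset_univ S)]

theorem two_mul_blocksThrough (h : IsSimpleDesign 3 v 4 lam 𝓑) {T : Finset V} (hT : T.card = 2) :
    2 * blocksThrough 𝓑 T = lam * (v - 2) := by
  have := h.blocksThrough_insert (S := T) (r := lam) fun w hw =>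
    h.blocksThrough_triple (by rw [Finset.card_insert_of_notMem hw, hT])
  rw [hT] at this
  rw [mul_comm lam, this, mul_comm]

theorem six_mul_blocksThrough (h : IsSimpleDesign 3 v 4 lam 𝓑) {T : Finset V} (hT : T.card = 1) :
    6 * blocksThrough 𝓑 T = lam * (v - 2) * (v - 1) := by
  have h1 : (v - 1) * (lam * (v - 2)) = 2 * (blocksThrough 𝓑 T * 3) := by
    have key := sum_blocksThrough_insert h.card_block T
    rw [hT] at key
    rw [show 4 - 1 = 3 from rfl] at key
    rw [← key, Finset.mul_sum, Finset.sum_congr rfl (fun w hw =>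
      h.two_mul_blocksThrough (T := insert w T) (by
        rw [Finset.card_insert_of_notMem (by simpa using hw), hT])), Finset.sum_const, smul_eq_mul,
      Finset.card_sdiff_of_subset (Finset.subset_univ T), Finset.card_univ, h.card_points, hT]
  linarith

theorem twentyfour_mul_card (h : IsSimpleDesign 3 v 4 lam 𝓑) :
    24 * 𝓑.card = lam * (v - 2) * (v - 1) * v := by
  have h1 : v * (lam * (v - 2) * (v - 1)) = 6 * (𝓑.card * 4) := by
    have key := sum_blocksThrough_insert h.card_block (∅ : Finset V)
    have h0 : blocksThrough 𝓑 ∅ = 𝓑.card := by simp [blocksThrough]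
    rw [Finset.card_empty, Nat.sub_zero, h0] at key
    rw [← key, Finset.mul_sum, Finset.sum_congr rfl (fun w _ =>
      h.six_mul_blocksThrough (T := insert w ∅) (by simp)), Finset.sum_const, smul_eq_mul,
      Finset.sdiff_empty, Finset.card_univ, h.card_points]
  linarith

/-- Inclusion-exclusion with the known counts for sizes 0 to 3. Only the term of size 4 depends on
more than the parameters: a 4-set in `S` contributes exactly when it is a block. -/
theorem card_disjoint_eq (h : IsSimpleDesign 3 v 4 lam 𝓑) (hv : 2 ≤ v) (S : Finset V) :
    24 * ((𝓑.filter fun B => Disjoint S B).card : ℤ)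
      = lam * ((v - 2) * (v - 1) * v - 4 * S.card * ((v - 2) * (v - 1))
        + 12 * (S.card.choose 2) * (v - 2) - 24 * S.card.choose 3)
        + 24 * (𝓑.filter fun B => B ⊆ S).card := by
  have h0 : ∑ T ∈ S.powersetCard 0, blocksThrough 𝓑 T = 𝓑.card := by simp [blocksThrough]
  have h1 : 6 * ∑ T ∈ S.powersetCard 1, blocksThrough 𝓑 T
      = S.card * (lam * (v - 2) * (v - 1)) := by
    rw [Finset.mul_sum, Finset.sum_congr rfl (fun T hT => h.six_mul_blocksThrough
      (Finset.mem_powersetCard.1 hT).2), Finset.sum_const, Finset.card_powersetCard]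
    simp
  have h2 : 2 * ∑ T ∈ S.powersetCard 2, blocksThrough 𝓑 T
      = S.card.choose 2 * (lam * (v - 2)) := by
    rw [Finset.mul_sum, Finset.sum_congr rfl (fun T hT => h.two_mul_blocksThrough
      (Finset.mem_powersetCard.1 hT).2), Finset.sum_const, Finset.card_powersetCard, smul_eq_mul]
  have h3 : ∑ T ∈ S.powersetCard 3, blocksThrough 𝓑 T = S.card.choose 3 * lam := by
    rw [Finset.sum_congr rfl (fun T hT => h.blocksThrough_triple
      (Finset.mem_powersetCard.1 hT).2), Finset.sum_const, Finset.card_powersetCard, smul_eq_mul]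
  have h4 : ∑ T ∈ S.powersetCard 4, blocksThrough 𝓑 T = (𝓑.filter fun B => B ⊆ S).card := by
    rw [sum_powersetCard_blocksThrough, Finset.card_filter]
    apply Finset.sum_congr rfl
    intro B hB
    have hB4 := h.card_block B hB
    split_ifs with hs
    · rw [Finset.inter_eq_right.2 hs, hB4]; rfl
    · apply Nat.choose_eq_zero_of_lt
      rw [← hB4]
      apply Finset.card_lt_card
      refine ⟨Finset.inter_subset_right, fun hc => hs (hc.trans Finset.inter_subset_left)⟩
  have hb := h.twentyfour_mul_card
  have key := card_blocks_disjoint h.card_block S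
  simp only [Finset.sum_range_succ, Finset.sum_range_zero] at key
  zify [hv, (by omega : 1 ≤ v)] at h0 h1 h2 h3 h4 hb
  rw [key, h0, h3, h4]
  linear_combination hb - 4 * h1 + 12 * h2

theorem exists_ne_block_of_pair (h : IsSimpleDesign 3 v 4 lam 𝓑) (hlam : 1 ≤ lam) (hv : 6 ≤ v)
    {p q : V} (hpq : p ≠ q) (C : Finset V) : ∃ B ∈ 𝓑, p ∈ B ∧ q ∈ B ∧ B ≠ C := by
  have h2 := h.two_mul_blocksThrough (T := {p, q}) (Finset.card_pair hpq)
  have : 1 < (𝓑.filter fun B => {p, q} ⊆ B).card := by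
    change 1 < blocksThrough 𝓑 {p, q}
    have : 1 * 4 ≤ lam * (v - 2) := Nat.mul_le_mul hlam (by omega)
    omega
  obtain ⟨B, hB, hne⟩ := Finset.exists_mem_ne this C
  rw [Finset.mem_filter, Finset.insert_subset_iff, Finset.singleton_subset_iff] at hB
  exact ⟨B, hB.1, hB.2.1, hB.2.2, hne⟩

/-- The block `B` inside `S` is essential at `v = 16`, where the rest of the count vanishes. -/
theorem exists_block_disjoint_of_card_eight (h : IsSimpleDesign 3 v 4 lam 𝓑) (hv : 16 ≤ v)
    {S B : Finset V} (hS : S.card = 8) (hB : B ∈ 𝓑) (hBS : B ⊆ S) : ∃ C ∈ 𝓑, Disjoint S C := by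
  by_contra! hcon
  have key := h.card_disjoint_eq (by omega) S
  rw [Finset.filter_false_of_mem hcon, hS] at key
  have hpos : 0 < (𝓑.filter fun B => B ⊆ S).card :=
    Finset.card_pos.2 ⟨B, by simp [hB, hBS]⟩
  obtain ⟨u, rfl⟩ := Nat.exists_eq_add_of_le hv
  have e2 : Nat.choose 8 2 = 28 := rfl
  have e3 : Nat.choose 8 3 = 56 := rfl
  rw [e2, e3] at key
  push_cast at key
  -- This is the factor of `lam` in the count after substituting `v = 16 + u` and `|S| = 8`; its
  -- constant term is zero.
  have hl : (0 : ℤ) ≤ lam * (u ^ 3 + 13 * u ^ 2 + 82 * u) := by positivity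
  have hpos' : (0 : ℤ) < (𝓑.filter fun B => B ⊆ S).card := by exact_mod_cast hpos
  simp only [Finset.card_empty, Nat.cast_zero, mul_zero] at key
  linarith

end IsSimpleDesign

end Counting

/-! ### Existential closure, and obstructions to it in block intersection graphs. -/

section Closure

theorem existentialClosureNumber_eq_two {W : Type*} [DecidableEq W] {G : SimpleGraph W}
    (h1 : IsExistentiallyClosed G 1) (h2 : IsExistentiallyClosed G 2)
    (h3 : ¬ IsExistentiallyClosed G 3) : existentialClosureNumber G = 2 := by
  apply le_antisymm
  · apply sSup_le
    rintro x ⟨n, rfl, hn⟩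
    by_contra hlt
    have : 3 ≤ n := by
      by_contra h
      exact hlt (by exact_mod_cast (by omega : n ≤ 2))
    exact h3 (hn 3 (by norm_num) this)
  · apply le_sSup
    refine ⟨2, rfl, fun m hm1 hm2 => ?_⟩
    interval_cases m <;> assumption

theorem closed_of_existentialClosureNumber_eq_two {W : Type*} [DecidableEq W] {G : SimpleGraph W}
    (h : existentialClosureNumber G = 2) {m : ℕ} (hm1 : 1 ≤ m) (hm2 : m ≤ 2) :
    IsExistentiallyClosed G m := by
  by_contra hc
  have : existentialClosureNumber G ≤ 1 := by
    apply sSup_le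
    rintro x ⟨n, rfl, hn⟩
    have : n ≤ 1 := by
      by_contra h2
      exact hc (hn m hm1 (by omega))
    exact_mod_cast this
  rw [h] at this
  exact absurd this (by decide)

/-- Without vertices no `A ∪ B` has positive size, so every closure condition holds vacuously. -/
theorem existentialClosureNumber_ne_two_of_isEmpty {W : Type*} [DecidableEq W] [IsEmpty W]
    (G : SimpleGraph W) : existentialClosureNumber G ≠ 2 := by
  intro h
  have : ((3 : ℕ) : ℕ∞) ≤ existentialClosureNumber G := by
    apply le_sSup
    refine ⟨3, rfl, fun m hm _ A B _ hcard => ?_⟩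
    rw [Finset.eq_empty_of_isEmpty (A ∪ B), Finset.card_empty] at hcard
    omega
  rw [h] at this
  exact absurd this (by decide)

variable {V : Type*} [DecidableEq V] {𝓑 : Finset (Finset V)}

/-- Two vertices can be distributed over `A` and `B` in four ways; the two mixed ones are exchanged
by symmetry, which leaves three hypotheses. -/
theorem isExistentiallyClosed_two
    (hboth : ∀ B ∈ 𝓑, ∀ C ∈ 𝓑, B ≠ C →
      ∃ D ∈ 𝓑, D ≠ B ∧ D ≠ C ∧ (D ∩ B).Nonempty ∧ (D ∩ C).Nonempty)
    (hone : ∀ B ∈ 𝓑, ∀ C ∈ 𝓑, B ≠ C →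
      ∃ D ∈ 𝓑, D ≠ B ∧ D ≠ C ∧ (D ∩ B).Nonempty ∧ ¬ (D ∩ C).Nonempty)
    (hnone : ∀ B ∈ 𝓑, ∀ C ∈ 𝓑, B ≠ C →
      ∃ D ∈ 𝓑, D ≠ B ∧ D ≠ C ∧ ¬ (D ∩ B).Nonempty ∧ ¬ (D ∩ C).Nonempty) :
    IsExistentiallyClosed (blockIntersectionGraph 𝓑) 2 := by
  intro A B hdisj hcard
  obtain ⟨x, y, hxy, hAB⟩ := Finset.card_eq_two.1 hcard
  have hne : x.1 ≠ y.1 := fun h => hxy (Subtype.ext h)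
  have hmem : ∀ z, z ∈ A ∪ B ↔ z = x ∨ z = y := fun z => by simp [hAB]
  have hor : ∀ z, (z = x ∨ z = y) → z ∈ A ∨ z ∈ B := fun z hz =>
    Finset.mem_union.1 ((hmem z).2 hz)
  have hex : ∀ z, z ∈ A → z ∉ B := fun z hz hz' => Finset.disjoint_left.1 hdisj hz hz'
  have build : ∀ D : Finset V, ∀ hD : D ∈ 𝓑, D ≠ x.1 → D ≠ y.1 →
      (x ∈ A → (D ∩ x.1).Nonempty) → (y ∈ A → (D ∩ y.1).Nonempty) →
      (x ∈ B → ¬ (D ∩ x.1).Nonempty) → (y ∈ B → ¬ (D ∩ y.1).Nonempty) →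
      ∃ z : {B : Finset V // B ∈ 𝓑}, z ∉ A ∪ B ∧
        (∀ a ∈ A, (blockIntersectionGraph 𝓑).Adj z a) ∧
        (∀ b ∈ B, ¬ (blockIntersectionGraph 𝓑).Adj z b) := by
    intro D hD hx hy hxA hyA hxB hyB
    have hx' : (⟨D, hD⟩ : {B : Finset V // B ∈ 𝓑}) ≠ x := fun h => hx (congrArg Subtype.val h)
    have hy' : (⟨D, hD⟩ : {B : Finset V // B ∈ 𝓑}) ≠ y := fun h => hy (congrArg Subtype.val h)
    refine ⟨⟨D, hD⟩, fun h => ((hmem _).1 h).elim hx' hy', fun a ha => ?_, fun b hb hadj => ?_⟩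
    · rcases (hmem a).1 (Finset.mem_union_left _ ha) with rfl | rfl
      · exact ⟨hx', hxA ha⟩
      · exact ⟨hy', hyA ha⟩
    · rcases (hmem b).1 (Finset.mem_union_right _ hb) with rfl | rfl
      · exact hxB hb hadj.2
      · exact hyB hb hadj.2
  rcases hor x (Or.inl rfl) with hx | hx <;> rcases hor y (Or.inr rfl) with hy | hy
  · obtain ⟨D, hD, h1, h2, h3, h4⟩ := hboth _ x.2 _ y.2 hne
    exact build D hD h1 h2 (fun _ => h3) (fun _ => h4) (fun h => absurd h (hex _ hx))
      (fun h => absurd h (hex _ hy))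
  · obtain ⟨D, hD, h1, h2, h3, h4⟩ := hone _ x.2 _ y.2 hne
    exact build D hD h1 h2 (fun _ => h3) (fun h => absurd hy (hex _ h))
      (fun h => absurd h (hex _ hx)) (fun _ => h4)
  · obtain ⟨D, hD, h1, h2, h3, h4⟩ := hone _ y.2 _ x.2 hne.symm
    exact build D hD h2 h1 (fun h => absurd hx (hex _ h)) (fun _ => h3)
      (fun _ => h4) (fun h => absurd h (hex _ hy))
  · obtain ⟨D, hD, h1, h2, h3, h4⟩ := hnone _ x.2 _ y.2 hne
    exact build D hD h1 h2 (fun h => absurd hx (hex _ h)) (fun h => absurd hy (hex _ h))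
      (fun _ => h3) (fun _ => h4)

/-- Pad the single vertex with any other one, placed in `A`. -/
theorem isExistentiallyClosed_one_of_two {W : Type*} [DecidableEq W] {G : SimpleGraph W}
    (hW : ∀ x : W, ∃ y, y ≠ x) (h : IsExistentiallyClosed G 2) : IsExistentiallyClosed G 1 := by
  intro A B hdisj hcard
  obtain ⟨x, hx⟩ := Finset.card_eq_one.1 hcard
  obtain ⟨y, hy⟩ := hW x
  have hyAB : y ∉ A ∪ B := by simpa [hx] using hy
  obtain ⟨z, hz, hzA, hzB⟩ := h (insert y A) B
    (Finset.disjoint_insert_left.2 ⟨fun h => hyAB (Finset.mem_union_right _ h), hdisj⟩)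
    (by rw [Finset.insert_union, Finset.card_insert_of_notMem hyAB, hcard])
  refine ⟨z, fun h => hz ?_, fun a ha => hzA a (Finset.mem_insert_of_mem ha), hzB⟩
  rw [Finset.insert_union]
  exact Finset.mem_insert_of_mem h

/-- The obstruction used for orders 8, 10 and 14: nothing can be non-adjacent to both `B` and `C`.
-/
theorem not_isExistentiallyClosed_two {B C : Finset V} (hB : B ∈ 𝓑) (hC : C ∈ 𝓑) (hne : B ≠ C)
    (h : ∀ D ∈ 𝓑, ¬ Disjoint D (B ∪ C)) :
    ¬ IsExistentiallyClosed (blockIntersectionGraph 𝓑) 2 := by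
  intro hec
  have hne' : (⟨B, hB⟩ : {B : Finset V // B ∈ 𝓑}) ≠ ⟨C, hC⟩ := fun h => hne (congrArg Subtype.val h)
  obtain ⟨z, hz, -, hzB⟩ := hec ∅ {⟨B, hB⟩, ⟨C, hC⟩} (Finset.disjoint_empty_left _)
    (by rw [Finset.empty_union, Finset.card_pair hne'])
  simp only [Finset.empty_union, Finset.mem_insert, Finset.mem_singleton, not_or] at hz
  have key : ∀ E : {B : Finset V // B ∈ 𝓑}, E ∈ ({⟨B, hB⟩, ⟨C, hC⟩} : Finset {B : Finset V // B ∈ 𝓑}) →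
      z ≠ E → Disjoint z.1 E.1 := by
    intro E hE hzE
    rw [Finset.disjoint_iff_inter_eq_empty, ← Finset.not_nonempty_iff_eq_empty]
    exact fun hn => hzB E hE ⟨hzE, hn⟩
  exact h z.1 z.2 (Finset.disjoint_union_right.2
    ⟨key ⟨B, hB⟩ (by simp) hz.1, key ⟨C, hC⟩ (by simp) hz.2⟩)

/-- A block that meets `D` meets `B` or `C`, so no vertex is adjacent to `D` alone among the three.
-/
theorem not_isExistentiallyClosed_three {B C D : Finset V} (hB : B ∈ 𝓑) (hC : C ∈ 𝓑) (hD : D ∈ 𝓑)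
    (hBC : B ≠ C) (hDB : D ≠ B) (hDC : D ≠ C) (h : D ⊆ B ∪ C) :
    ¬ IsExistentiallyClosed (blockIntersectionGraph 𝓑) 3 := by
  intro hec
  have hBC' : (⟨B, hB⟩ : {B : Finset V // B ∈ 𝓑}) ≠ ⟨C, hC⟩ := fun h => hBC (congrArg Subtype.val h)
  have hDB' : (⟨D, hD⟩ : {B : Finset V // B ∈ 𝓑}) ≠ ⟨B, hB⟩ := fun h => hDB (congrArg Subtype.val h)
  have hDC' : (⟨D, hD⟩ : {B : Finset V // B ∈ 𝓑}) ≠ ⟨C, hC⟩ := fun h => hDC (congrArg Subtype.val h)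
  obtain ⟨z, hz, hzA, hzB⟩ := hec {⟨D, hD⟩} {⟨B, hB⟩, ⟨C, hC⟩} (by simp [hDB, hDC])
    (by
      rw [Finset.singleton_union, Finset.card_insert_of_notMem (by simp [hDB, hDC]),
        Finset.card_pair hBC'])
  simp only [Finset.mem_union, Finset.mem_insert, Finset.mem_singleton, not_or] at hz
  obtain ⟨p, hp⟩ := (hzA ⟨D, hD⟩ (by simp)).2
  rw [Finset.mem_inter] at hp
  rcases Finset.mem_union.1 (h hp.2) with hq | hq
  · exact hzB ⟨B, hB⟩ (by simp) ⟨hz.2.1, p, Finset.mem_inter.2 ⟨hp.1, hq⟩⟩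
  · exact hzB ⟨C, hC⟩ (by simp) ⟨hz.2.2, p, Finset.mem_inter.2 ⟨hp.1, hq⟩⟩

end Closure

/-! ### Simple quadruple systems of order at least 16, and small Steiner quadruple systems. -/

section Designs

variable {V : Type*} [Fintype V] [DecidableEq V] {v lam : ℕ} {𝓑 : Finset (Finset V)}

namespace IsSimpleDesign

/-- Split a block `C` into the pairs `{p, q}` and `{r, s}`. Each pair lies in at least two blocks,
so there are blocks `B` and `D` other than `C` through them, and `C ⊆ B ∪ D`. -/
theorem not_isExistentiallyClosed_three (h : IsSimpleDesign 3 v 4 lam 𝓑) (hlam : 1 ≤ lam)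
    (hv : 6 ≤ v) : ¬ IsExistentiallyClosed (blockIntersectionGraph 𝓑) 3 := by
  have hcard : 1 < Fintype.card V := by rw [h.card_points]; omega
  obtain ⟨p, q, hpq⟩ := Fintype.exists_pair_of_one_lt_card hcard
  obtain ⟨C, hC, hpC, hqC, -⟩ := h.exists_ne_block_of_pair hlam hv hpq ∅
  have hC4 := h.card_block C hC
  obtain ⟨r, s, hrs, hrs'⟩ := Finset.card_eq_two.1
    (show (C \ {p, q}).card = 2 by
      rw [Finset.card_sdiff_of_subset (by simp [Finset.insert_subset_iff, hpC, hqC]), hC4,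
        Finset.card_pair hpq])
  have hr : r ∈ C := (Finset.mem_sdiff.1 (hrs' ▸ Finset.mem_insert_self r {s})).1
  have hs : s ∈ C := (Finset.mem_sdiff.1 (hrs' ▸ Finset.mem_insert_of_mem
    (Finset.mem_singleton_self s) : s ∈ C \ {p, q})).1
  have hsub : ∀ x ∈ C, x = p ∨ x = q ∨ x = r ∨ x = s := by
    intro x hx
    by_cases hxp : x = p
    · exact Or.inl hxp
    by_cases hxq : x = q
    · exact Or.inr (Or.inl hxq)
    have : x ∈ C \ {p, q} := by simp [hx, hxp, hxq]
    rw [hrs'] at this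
    simpa using Or.inr (Or.inr this)
  obtain ⟨B, hB, hpB, hqB, hBC⟩ := h.exists_ne_block_of_pair hlam hv hpq C
  obtain ⟨D, hD, hrD, hsD, hDC⟩ := h.exists_ne_block_of_pair hlam hv hrs C
  -- If they coincided, the common block would contain all four points of `C` and hence equal `C`.
  by_cases hBD : B = D
  · subst hBD
    exfalso
    apply hBC
    symm
    apply Finset.eq_of_subset_of_card_le
    · intro x hx
      rcases hsub x hx with rfl | rfl | rfl | rfl <;> assumption
    · rw [hC4, h.card_block B hB]
  · refine _root_.not_isExistentiallyClosed_three hB hD hC hBD hBC.symm hDC.symm fun x hx => ?_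
    rcases hsub x hx with rfl | rfl | rfl | rfl <;> simp [*]

/-- A pair with one point in `B` and the other in `C` lies in `lam * (v - 2) / 2 ≥ 7` blocks, more
than the two to be avoided. -/
theorem exists_block_meeting_both (h : IsSimpleDesign 3 v 4 lam 𝓑) (hlam : 1 ≤ lam) (hv : 16 ≤ v)
    {B C : Finset V} (hB : B ∈ 𝓑) (hC : C ∈ 𝓑) :
    ∃ D ∈ 𝓑, D ≠ B ∧ D ≠ C ∧ (D ∩ B).Nonempty ∧ (D ∩ C).Nonempty := by
  have hB4 := h.card_block B hB
  have hC4 := h.card_block C hC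
  obtain ⟨p, hp⟩ := Finset.card_pos.1 (by omega : 0 < B.card)
  obtain ⟨q, hq, hqp⟩ := Finset.exists_mem_ne (by omega : 1 < C.card) p
  have h2 := h.two_mul_blocksThrough (T := {p, q}) (Finset.card_pair hqp.symm)
  have h14 : 1 * 14 ≤ lam * (v - 2) := Nat.mul_le_mul hlam (by omega)
  have hlt : ({B, C} : Finset (Finset V)).card < (𝓑.filter fun D => {p, q} ⊆ D).card := by
    have := Finset.card_le_two (a := B) (b := C)
    change _ < blocksThrough 𝓑 {p, q}
    omega
  obtain ⟨D, hD, hDBC⟩ := Finset.exists_mem_notMem_of_card_lt_card hlt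
  rw [Finset.mem_filter, Finset.insert_subset_iff, Finset.singleton_subset_iff] at hD
  simp only [Finset.mem_insert, Finset.mem_singleton, not_or] at hDBC
  exact ⟨D, hD.1, hDBC.1, hDBC.2, ⟨p, by simp [hD.2.1, hp]⟩, ⟨q, by simp [hD.2.2, hq]⟩⟩

/-- Put `L = lam * (v - 2)` and take `p ∈ B \ C`. At least `15 * L / 6` blocks contain `p`, and at
most `4 * L / 2` of them meet `C`. The difference is at least `L / 2 ≥ 7`, so a block other than `B`
remains. -/
theorem exists_block_meeting_one (h : IsSimpleDesign 3 v 4 lam 𝓑) (hlam : 1 ≤ lam) (hv : 16 ≤ v)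
    {B C : Finset V} (hB : B ∈ 𝓑) (hC : C ∈ 𝓑) (hne : B ≠ C) :
    ∃ D ∈ 𝓑, D ≠ B ∧ D ≠ C ∧ (D ∩ B).Nonempty ∧ ¬ (D ∩ C).Nonempty := by
  have hB4 := h.card_block B hB
  have hC4 := h.card_block C hC
  obtain ⟨p, hpB, hpC⟩ : ∃ p ∈ B, p ∉ C := by
    by_contra! hcon
    exact hne (Finset.eq_of_subset_of_card_le hcon (by omega))
  have h1 := h.six_mul_blocksThrough (T := {p}) (Finset.card_singleton p)
  -- blocks through `p` that meet `C`
  let 𝓜 : Finset (Finset V) := C.biUnion fun q => 𝓑.filter fun D => {p, q} ⊆ D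
  have hM : 2 * 𝓜.card ≤ 4 * (lam * (v - 2)) := by
    have : 𝓜.card ≤ ∑ q ∈ C, blocksThrough 𝓑 {p, q} := Finset.card_biUnion_le
    calc 2 * 𝓜.card ≤ 2 * ∑ q ∈ C, blocksThrough 𝓑 {p, q} := by omega
      _ = ∑ q ∈ C, lam * (v - 2) := by
        rw [Finset.mul_sum]
        refine Finset.sum_congr rfl fun q hq => h.two_mul_blocksThrough (Finset.card_pair ?_)
        rintro rfl
        exact hpC hq
      _ = 4 * (lam * (v - 2)) := by rw [Finset.sum_const, hC4, smul_eq_mul]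
  have hbig : lam * (v - 2) * 15 ≤ lam * (v - 2) * (v - 1) := Nat.mul_le_mul_left _ (by omega)
  have h14 : 1 * 14 ≤ lam * (v - 2) := Nat.mul_le_mul hlam (by omega)
  have hlt : (insert B 𝓜).card < (𝓑.filter fun D => {p} ⊆ D).card := by
    have := Finset.card_insert_le B 𝓜
    change _ < blocksThrough 𝓑 {p}
    omega
  obtain ⟨D, hD, hDM⟩ := Finset.exists_mem_notMem_of_card_lt_card hlt
  rw [Finset.mem_filter, Finset.singleton_subset_iff] at hD
  simp only [Finset.mem_insert, not_or] at hDM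
  refine ⟨D, hD.1, hDM.1, ?_, ⟨p, by simp [hD.2, hpB]⟩, ?_⟩
  · rintro rfl
    exact hpC hD.2
  · rintro ⟨q, hq⟩
    rw [Finset.mem_inter] at hq
    apply hDM.2
    simp only [𝓜, Finset.mem_biUnion, Finset.mem_filter]
    exact ⟨q, hq.2, hD.1, by simp [Finset.insert_subset_iff, hD.2, hq.1]⟩

theorem exists_block_meeting_none (h : IsSimpleDesign 3 v 4 lam 𝓑) (hv : 16 ≤ v)
    {B C : Finset V} (hB : B ∈ 𝓑) (hC : C ∈ 𝓑) :
    ∃ D ∈ 𝓑, D ≠ B ∧ D ≠ C ∧ ¬ (D ∩ B).Nonempty ∧ ¬ (D ∩ C).Nonempty := by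
  have hB4 := h.card_block B hB
  have hC4 := h.card_block C hC
  have hle : (B ∪ C).card ≤ 8 := (Finset.card_union_le B C).trans (by omega)
  -- Enlarging the union to exactly eight points makes one count serve for all sizes of `B ∩ C`.
  obtain ⟨S, hBCS, -, hS⟩ := Finset.exists_subsuperset_card_eq (Finset.subset_univ (B ∪ C)) hle
    (by rw [Finset.card_univ, h.card_points]; omega)
  have hBS : B ⊆ S := Finset.subset_union_left.trans hBCS
  have hCS : C ⊆ S := Finset.subset_union_right.trans hBCS
  obtain ⟨D, hD, hSD⟩ := h.exists_block_disjoint_of_card_eight hv hS hB hBS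
  have hD4 := h.card_block D hD
  have hdisj : ∀ E ⊆ S, D ∩ E = ∅ := fun E hE =>
    Finset.disjoint_iff_inter_eq_empty.1 (Finset.disjoint_of_subset_left hE hSD).symm
  have hneq : ∀ E ⊆ S, D ≠ E := by
    rintro E hE rfl
    have := hdisj D hE
    rw [Finset.inter_self] at this
    rw [this, Finset.card_empty] at hD4
    omega
  refine ⟨D, hD, hneq B hBS, hneq C hCS, ?_, ?_⟩
  · simp [hdisj B hBS]
  · simp [hdisj C hCS]

theorem existentialClosureNumber_eq_two (h : IsSimpleDesign 3 v 4 lam 𝓑) (hlam : 1 ≤ lam)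
    (hv : 16 ≤ v) : existentialClosureNumber (blockIntersectionGraph 𝓑) = 2 := by
  have h2 : IsExistentiallyClosed (blockIntersectionGraph 𝓑) 2 :=
    isExistentiallyClosed_two (fun B hB C hC _ => h.exists_block_meeting_both hlam hv hB hC)
      (fun B hB C hC hne => h.exists_block_meeting_one hlam hv hB hC hne)
      (fun B hB C hC _ => h.exists_block_meeting_none hv hB hC)
  refine _root_.existentialClosureNumber_eq_two (isExistentiallyClosed_one_of_two ?_ h2) h2
    (h.not_isExistentiallyClosed_three hlam (by omega))
  rintro ⟨B, hB⟩
  -- Taking both blocks equal to `B` supplies a second vertex.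
  obtain ⟨D, hD, hDB, -⟩ := h.exists_block_meeting_none hv hB hB
  exact ⟨⟨D, hD⟩, fun hc => hDB (congrArg Subtype.val hc)⟩

theorem not_disjoint_union_of_card_lt (h : IsSimpleDesign 3 v 4 lam 𝓑) {S D : Finset V}
    (hS : v < S.card + 4) (hD : D ∈ 𝓑) : ¬ Disjoint D S := by
  intro hdisj
  have := Finset.card_le_univ (D ∪ S)
  rw [Finset.card_union_of_disjoint hdisj, h.card_block D hD, h.card_points] at this
  omega

/-- Two distinct blocks cover at least five of the eight points, so no block fits into the
complement. -/
theorem not_isExistentiallyClosed_two_of_eight (h : IsSimpleDesign 3 8 4 1 𝓑) :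
    ¬ IsExistentiallyClosed (blockIntersectionGraph 𝓑) 2 := by
  have hcard : 1 < Fintype.card V := by rw [h.card_points]; omega
  obtain ⟨p, q, hpq⟩ := Fintype.exists_pair_of_one_lt_card hcard
  obtain ⟨B, hB, hpB, hqB, -⟩ := h.exists_ne_block_of_pair le_rfl (by norm_num) hpq ∅
  obtain ⟨C, hC, hpC, hqC, hCB⟩ := h.exists_ne_block_of_pair le_rfl (by norm_num) hpq B
  have hlt : B ⊂ B ∪ C := by
    refine ⟨Finset.subset_union_left, fun hsub => hCB ?_⟩
    exact Finset.eq_of_subset_of_card_le (Finset.subset_union_right.trans hsub)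
      (by rw [h.card_block B hB, h.card_block C hC])
  have := Finset.card_lt_card hlt
  rw [h.card_block B hB] at this
  exact not_isExistentiallyClosed_two hB hC hCB.symm fun D hD =>
    h.not_disjoint_union_of_card_lt (by omega) hD

/-- The count for `S = B` is at least `48 / 24 = 2`, so some block is disjoint from `B`; the two
together leave only two points. -/
theorem not_isExistentiallyClosed_two_of_ten (h : IsSimpleDesign 3 10 4 1 𝓑) :
    ¬ IsExistentiallyClosed (blockIntersectionGraph 𝓑) 2 := by
  have hb := h.twentyfour_mul_card
  obtain ⟨B, hB⟩ := Finset.card_pos.1 (by omega : 0 < 𝓑.card)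
  have key := h.card_disjoint_eq (by norm_num) B
  rw [h.card_block B hB, show Nat.choose 4 2 = 6 from rfl, show Nat.choose 4 3 = 4 from rfl] at key
  push_cast at key
  have : (𝓑.filter fun C => Disjoint B C).Nonempty := by
    rw [← Finset.card_pos]
    zify
    have : (0 : ℤ) ≤ (𝓑.filter fun C => C ⊆ B).card := by positivity
    linarith
  obtain ⟨C, hC⟩ := this
  rw [Finset.mem_filter] at hC
  have hne : B ≠ C := by
    rintro rfl
    have := h.card_block B hB
    rw [disjoint_self.1 hC.2] at this
    exact absurd this (by simp)
  refine not_isExistentiallyClosed_two hB hC.1 hne fun D hD =>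
    h.not_disjoint_union_of_card_lt ?_ hD
  rw [Finset.card_union_of_disjoint hC.2, h.card_block B hB, h.card_block C hC.1]
  norm_num

theorem not_isExistentiallyClosed_one_of_four (h : IsSimpleDesign 3 4 4 1 𝓑) :
    ¬ IsExistentiallyClosed (blockIntersectionGraph 𝓑) 1 := by
  have hb := h.twentyfour_mul_card
  obtain ⟨B, hB⟩ := Finset.card_eq_one.1 (by omega : 𝓑.card = 1)
  have hmem : B ∈ 𝓑 := by simp [hB]
  intro hec
  obtain ⟨z, hz, -⟩ := hec {⟨B, hmem⟩} ∅ (by simp) (by simp)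
  have huniq : ∀ D ∈ 𝓑, D = B := by simp [hB]
  exact hz (by simpa using Subtype.ext (huniq z.1 z.2))

end IsSimpleDesign

/-- The numbers of blocks through a pair and through a point are integers, so 2 divides `v - 2` and
6 divides `(v - 2) * (v - 1)`. -/
theorem IsSteinerQuadrupleSystem.order_cases (h : IsSteinerQuadrupleSystem v 𝓑) (hv : v < 16) :
    v < 3 ∨ v = 4 ∨ v = 8 ∨ v = 10 ∨ v = 14 := by
  have h : IsSimpleDesign 3 v 4 1 𝓑 := h
  by_cases h3 : v < 3
  · exact Or.inl h3
  have hcard : 1 < Fintype.card V := by rw [h.card_points]; omega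
  obtain ⟨p, q, hpq⟩ := Fintype.exists_pair_of_one_lt_card hcard
  have h2 := h.two_mul_blocksThrough (T := {p, q}) (Finset.card_pair hpq)
  have h1 := h.six_mul_blocksThrough (T := {p}) (Finset.card_singleton p)
  interval_cases v <;> omega

end Designs

/-! ### A kernel-executable search for quadruple systems on fourteen points

Blocks and triples on `Fin 14` are bit masks. The state of the search is one natural number: bit
`t + 364 * x` says that the block formed by the `t`-th triple and the point `x` is still available,
and bit `5824 + t` that no block through the `t`-th triple has been chosen yet. The functions are
written with the operations on `Nat` that the kernel evaluates on binary representations.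

It shows that every Steiner quadruple system of order fourteen has two disjoint blocks that meet
all the others. The blocks through a point form a Steiner triple system on the other thirteen
points; the two such systems are found by branching, and the search is run for each. -/

namespace QuadrupleSearch

/-- Lazy conditional. -/
@[reducible] noncomputable def sel (b x y : Bool) : Bool := @Bool.rec (fun _ => Bool) y x b

noncomputable def allBelow (n : Nat) (P : Nat → Bool) : Bool :=
  @Nat.rec (fun _ => Bool) true (fun i ih => sel (P i) ih false) n

noncomputable def allList {α : Type} (L : List α) (P : α → Bool) : Bool :=
  @List.rec α (fun _ => Bool) true (fun b _ ih => sel (P b) ih false) L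

noncomputable def anyList {α : Type} (L : List α) (P : α → Bool) : Bool :=
  @List.rec α (fun _ => Bool) false (fun b _ ih => sel (P b) true ih) L

/-- The bitwise union of the values of `f` on a list. -/
noncomputable def orList (L : List Nat) (f : Nat → Nat) : Nat :=
  @List.rec Nat (fun _ => Nat) 0 (fun b _ ih => Nat.lor (f b) ih) L

/-- The lowest bit of `x`. -/
noncomputable def low (x : Nat) : Nat := Nat.xor x (Nat.land x (Nat.sub x 1))

/-- The test that bit `i` of `x` vanishes. -/
noncomputable def bitFree (x i : Nat) : Bool := Nat.beq (Nat.land (Nat.shiftRight x i) 1) 0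

/-- The number of bits of `c` below position fourteen. -/
noncomputable def pop (c : Nat) : Nat :=
  @Nat.rec (fun _ => Nat) 0 (fun i ih => Nat.add ih (Nat.land (Nat.shiftRight c i) 1)) 14

/-- The rank of the triple `i < j < k`. -/
noncomputable def rank (i j k : Nat) : Nat :=
  -- The combinatorial number system `C(k,3) + C(j,2) + i`, reversed: triples with a large greatest
  -- point get the small ranks.
  Nat.sub 363 (Nat.add (Nat.div (Nat.mul k (Nat.mul (Nat.sub k 1) (Nat.sub k 2))) 6)
    (Nat.add (Nat.div (Nat.mul j (Nat.sub j 1)) 2) i))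

/-- The masks of the triples; the entry of rank `t` is stored at place `2 ^ t % 373`. -/
def tripleTable : Nat := 0x824208a090208401a8222c00206014400660488210209a80048220500c20508504005830281109208208c020818a40a4014011205022204812103048440506018140900500542180c041a0810980224421018204520300486008148842880441a201a004c00a04118006440850c0204600a046042402c240221080e004c060280528101404282400c242004e80108518400b0114006400528105050600522024200008303002818048814409802c010282141009080e1042208444284110210c0105a10024864000584a03008280900c114010901890124060092428008c2030c4080250880452204108808902a002c900480921041600340c1004a022418060058048610a02108213021200a041113800034090620100380079800418084941060800850a8000044800a20620046014402980c244041222805800380484080524104110000828828001cc004148814020a12100c414203042500c042a014024090122212202140182210701804840854022048881109c002820068440600c10a2404040c604a0802840912802620118001510604900000c0104902805030402a108112110404182500187010404410a40500940244c804242208022803120281813080228801862042121400448038880800b10854200218000029004900aa4808c00403201841220c0023054020c03203083021404049202208898081600890800c07080464081820288a01120142040001281041844110809830200430098340221000c818208c064086000430035440000004a940040510500250844310502202460408a0020e4100a41202000104244430400286220061068001154800130406009832080a08c090812044113080890070054004090d009014823100200c40a240b2001033400e000000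

/-- The masks of the points; the entry of `x` is stored at place `2 ^ (364 * x) % 373`. -/
def pointTable : Nat := 0x100000001000000000000000000000000000000000000000000000000000000000000000000000000000000001000000000000000000000000000000000000000000000000000000000000000000000000000000000000000000000000000000000000000000000000001000000000000000000000000000000000000000000000000000000000000000000000000000000000000000000000000000000000000000000000000000000000000000000000000000000000000000000000000000000000008000000000000000000000000000000000000000000000000000080000000000000000000000000000000000000000000000000000000000000000000000000000000000000000000000000000000000000000000000000000000000000000000000000000000000000000000000000000000000000000000000000000000000000000000000000000000000000000000000000000000000000000000000000000000000000000000000000000000000000000000000000000000000000000000000000000000000000000000000000000000000000000000000000000000000000000000000010000000000000000000000000000000000800000000000000000000000000020001000000000000000000000000000000000000000000000000000000000800000000000000000000000000000000000000000000000000000000000000000000000000000000000000000000000000000000000000000080000000000000000000000000000000000000000000000000000000000000000000000000200000000000000000000000000000000000000000000000000000000000000000000000000000000000000000000000000004000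

/-- The indices of the points; the entry of `x` is stored at place `2 ^ x % 19`. -/
def indexTable : Nat := 0x9a4b750c0836002d100

/-- Since 2 is a primitive root modulo the primes 19 and 373, the residue of a power of two
determines its exponent in the ranges that occur. A table indexed by residues thus replaces a
discrete logarithm. -/
noncomputable def index (p : Nat) : Nat :=
  Nat.land (Nat.shiftRight indexTable (Nat.mul 4 (Nat.mod p 19))) 15

noncomputable def tripleMask (p : Nat) : Nat :=
  Nat.land (Nat.shiftRight tripleTable (Nat.mul 14 (Nat.mod p 373))) 16383

/-- The block at position `t + 364 * x`, given `p = 2 ^ t` and `j = 2 ^ (364 * x)`. -/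
noncomputable def blockAt (p j : Nat) : Nat :=
  Nat.lor (tripleMask p) (Nat.land (Nat.shiftRight pointTable (Nat.mul 14 (Nat.mod j 373))) 16383)

/-- Passes the four bits of a block mask to `k`. -/
noncomputable def split4 {α : Type} (c : Nat) (k : Nat → Nat → Nat → Nat → α) : α :=
  (fun a => (fun r => (fun b => (fun s => (fun d => k a b d (Nat.xor s d)) (low s)) (Nat.xor r b))
    (low r)) (Nat.xor c a)) (low c)

noncomputable def positionList (a b c d : Nat) : List Nat :=
  [Nat.add (rank b c d) (Nat.mul 364 a), Nat.add (rank a c d) (Nat.mul 364 b),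
    Nat.add (rank a b d) (Nat.mul 364 c), Nat.add (rank a b c) (Nat.mul 364 d)]

/-- The four positions of a block. -/
noncomputable def positions (c : Nat) : List Nat :=
  split4 c fun p q r s => positionList (index p) (index q) (index r) (index s)

noncomputable def positionMask (c : Nat) : Nat := orList (positions c) (Nat.pow 2)

noncomputable def coveredMask (c : Nat) : Nat :=
  Nat.shiftLeft (orList (positions c) fun q => Nat.pow 2 (Nat.mod q 364)) 5824

/-- The positions of all blocks through the triple with mask `q + 1`. -/
noncomputable def throughAux (q : Nat) : Nat :=
  @Nat.rec (fun _ => Nat) 0 (fun x ih => Nat.lor ih (@Bool.rec (fun _ => Nat) 0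
    (positionMask (Nat.lor (Nat.succ q) (Nat.pow 2 x))) (bitFree (Nat.succ q) x))) 14

/-- The positions of all blocks through a triple. -/
noncomputable def through (m : Nat) : Nat :=
  -- No recursion takes place: the case split forces the mask to be evaluated to a numeral first.
  -- The same device is applied to the block in `search`.
  @Nat.rec (fun _ => Nat) 0 (fun q _ => Nat.lor 0 (throughAux q)) m

noncomputable def conflicts (c : Nat) : Nat := split4 c fun p q r s =>
  Nat.lor (Nat.lor (through (Nat.xor c p)) (through (Nat.xor c q)))
    (Nat.lor (through (Nat.xor c r)) (through (Nat.xor c s)))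

def ones (n : Nat) : Nat := Nat.sub (Nat.pow 2 n) 1
def allBits : Nat := ones 6188
def tripleBits : Nat := ones 364
def positionBits : Nat := ones 5096
def comb : Nat := 0x10000000000000000000000000000000000000000000000000000000000000000000000000000000000000000001000000000000000000000000000000000000000000000000000000000000000000000000000000000000000000100000000000000000000000000000000000000000000000000000000000000000000000000000000000000000010000000000000000000000000000000000000000000000000000000000000000000000000000000000000000001000000000000000000000000000000000000000000000000000000000000000000000000000000000000000000100000000000000000000000000000000000000000000000000000000000000000000000000000000000000000010000000000000000000000000000000000000000000000000000000000000000000000000000000000000000001000000000000000000000000000000000000000000000000000000000000000000000000000000000000000000100000000000000000000000000000000000000000000000000000000000000000000000000000000000000000010000000000000000000000000000000000000000000000000000000000000000000000000000000000000000001000000000000000000000000000000000000000000000000000000000000000000000000000000000000000000100000000000000000000000000000000000000000000000000000000000000000000000000000000000000000010000000000000000000000000000000000000000000000000000000000000000000000000000000000000000001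

/-- The bits that survive the choice of the block `c`. -/
noncomputable def keep (c : Nat) : Nat :=
  Nat.lor (Nat.xor allBits (Nat.lor (conflicts c) (coveredMask c))) (positionMask c)

noncomputable def keepSucc (q : Nat) : Nat := keep (Nat.succ q)

/-! The choice of the triples to branch on: the lowest 364 bits of `c₁`, `c₂`, `c₃` are the
triples with at least one, two, three available blocks, and `u` consists of the uncovered triples. -/

noncomputable def chooseThree (u w : Nat) : Nat := @Bool.rec (fun _ => Nat) (low w) (low u) (Nat.beq w 0)
noncomputable def chooseTwo (o c₂ c₃ u : Nat) : Nat :=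
  @Bool.rec (fun _ => Nat) o (chooseThree u (Nat.land (Nat.xor c₂ c₃) u)) (Nat.beq o 0)
noncomputable def chooseOne (z c₁ c₂ c₃ u : Nat) : Nat :=
  @Bool.rec (fun _ => Nat) (low (Nat.xor z tripleBits))
    (chooseTwo (Nat.land (Nat.xor c₁ c₂) u) c₂ c₃ u) (Nat.beq z tripleBits)
noncomputable def fold₇ (A a b c h i j : Nat) : Nat :=
  (fun a' => chooseOne (Nat.land a' tripleBits) a'
    (Nat.lor (Nat.lor b i) (Nat.land a h))
    (Nat.lor (Nat.lor c j) (Nat.lor (Nat.land b h) (Nat.land a i))) (Nat.shiftRight A 5824))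
    (Nat.lor a h)
noncomputable def fold₆ (A a b c : Nat) : Nat :=
  fold₇ A a b c (Nat.shiftRight a 364) (Nat.shiftRight b 364) (Nat.shiftRight c 364)
noncomputable def fold₅ (A a b c h i j : Nat) : Nat :=
  fold₆ A (Nat.lor a h) (Nat.lor (Nat.lor b i) (Nat.land a h))
    (Nat.lor (Nat.lor c j) (Nat.lor (Nat.land b h) (Nat.land a i)))
noncomputable def fold₄ (A a b c : Nat) : Nat :=
  fold₅ A a b c (Nat.shiftRight a 728) (Nat.shiftRight b 728) (Nat.shiftRight c 728)
noncomputable def fold₃ (A a b h i : Nat) : Nat :=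
  fold₄ A (Nat.lor a h) (Nat.lor (Nat.lor b i) (Nat.land a h))
    (Nat.lor (Nat.land b h) (Nat.land a i))
noncomputable def fold₂ (A a b : Nat) : Nat :=
  fold₃ A a b (Nat.shiftRight a 1456) (Nat.shiftRight b 1456)
-- The state consists of slots of 364 bits, one per point. Shifts by 8, 4, 2 and 1 slots accumulate
-- slots 0 to 15 in the lowest one, in parallel for all triples, with counts saturating at three.
noncomputable def fold₁ (A h : Nat) : Nat := fold₂ A (Nat.lor A h) (Nat.land A h)

/-- The triples to branch on next, as a set of bits: a triple without available blocks, all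
uncovered triples with exactly one available block, or some uncovered triple with few of them. -/
noncomputable def branchTriples (A : Nat) : Nat := fold₁ A (Nat.shiftRight A 2912)

/-- All available blocks are chosen, and two disjoint ones meet all the others. -/
noncomputable def leaf (A : Nat) (L : List Nat) : Bool :=
  sel (Nat.beq (Nat.land A positionBits) (orList L positionMask))
    (anyList L fun b => anyList L fun c => sel (Nat.beq (Nat.land b c) 0)
      (allList L fun e => sel (Nat.beq (Nat.land e (Nat.lor b c)) 0) false true) false) false

/-- The type of the continuation of a search step: available positions, chosen blocks, triples to
branch on, the current triple, and its remaining options. -/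
abbrev Step := Nat → List Nat → Nat → Nat → Nat → Bool

noncomputable def pick (A f : Nat) (L : List Nat) (k : Step) : Bool :=
  (fun p => sel (Nat.ble p tripleBits) (k A L f p (Nat.land (Nat.div A p) comb)) false) (low f)

noncomputable def next (A f : Nat) (L : List Nat) (k : Step) : Bool :=
  sel (Nat.beq f 0)
    ((fun g => sel (Nat.beq g 0) (leaf A L) (pick A g L k)) (branchTriples A)) (pick A f L k)

/-- Tries all options `y` for the block through the triple `p`. -/
noncomputable def search (n : Nat) : Step :=
  @Nat.rec (fun _ => Step) (fun _ _ _ _ _ => false)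
    -- With no option left the branch is closed. Otherwise the lowest option and the remaining ones
    -- must both succeed; running out of steps counts as failure.
    (fun _ ih A L f p y => sel (Nat.beq y 0) true
      ((fun j => @Nat.rec (fun _ => Bool) false (fun q _ =>
        sel ((fun A' => next A' (Nat.land f (Nat.shiftRight A' 5824)) (List.cons (Nat.succ q) L) ih)
            (Nat.land A (keepSucc q)))
          (ih A L f p (Nat.xor y j)) false) (blockAt p j)) (low y))) n

def allPositions : Nat := 0xfffffffffffffffffffffffffffffffffffffffffffffffffffffffffffffffffffffffffffffffffffffffffff00000000000000000000000000000000000000000000000000000000000000000000000000000000000000000000000000000000000000000000000000000000000000000000000000000000000000000000000000000000000000fffffffffffffffffffffffffffffffffffffffffffffffffffffffffffffffffffffffc0000000000000000000fffffffffffffffffffffffffffffffffffffffffffffffffffffff00000000000000003ffffffffffffffff000fffffffffffffffffffffffffffffffffffffffff80000000000000fffffffffffffe003fffffffffffff800ffeffffffffffffffffffffffffffffff000000000007ffffffffffc00fffffffffff801ffbffffffffffe007feffdfffffffffffffffffffff000000000fffffffff007ffffffff803fefffffffff007fdff7ffffffffc01ff7fdffbffffffffffffff0000000fffffff00ffffff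f00ff7ffffff807fbfdfffffff00ff7fbfefffffffc03fdfeffbff7ffffffffe00000fffff80fffff80fefffff80fefefffffc07f7f7fbfffff80fefeff7fdfffffe03fbfbfdff7feffffff0001fffc0fffe07efffe07efdfffe07efdfdffff03f7efeff7fffe07efdfdfeffbffff81fbf7f7fbfeffdfffc00ffc1ff83effc1f7dffc1f7dfbffc1f7dfbfbffe0fbefdfdfefffc1f7dfbfbfdff7fff07df7efeff7fdffbff03f0fc3df87bdfc3defbfc3defbf7fc3defbf7f7fe1ef7dfbfbfdffc3defbf7f7fbfefff0f7befdfdfeffbff7f8e38ee3bbc777be3bbdf7e3bbdf7efe3bbdf7efeff1ddefbf7f7fbfe3bbdf7efeff7fdff8eef7dfbfbfdff7feff49a6d9b7736ef79b77bef9b77befdf9b77befdfdfcdbbdf7efeff7f9b77befdfdfeffbfe6ddefbf7f7fbfeffdff2555b56eeaddef56ef7df56ef7dfbf56ef7dfbfbfab77befdfdfeff56ef7dfbfbfdff7fd5bbdf7efeff7fdffbff12cb72dde5bbdf2ddefbf2ddefbf7f2ddefbf7f7f96ef7dfbfbfdff2ddefbf7f7fbfeffcb77befdfdfeffbff7ff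

noncomputable def require (F : List Nat) : Nat :=
  @List.rec Nat (fun _ => Nat) allPositions (fun b _ ih => Nat.land ih (keep b)) F

noncomputable def exclude (X : List Nat) (A : Nat) : Nat :=
  @List.rec Nat (fun _ => Nat) A
    (fun b _ ih => Nat.xor ih (Nat.land ih (positionMask b))) X

noncomputable def isBlock (c : Nat) : Bool := sel (Nat.blt c 16384) (Nat.beq (pop c) 4) false

/-- The search over all systems containing the blocks `F` and none of the blocks `X`. -/
noncomputable def run (n : Nat) (F X : List Nat) : Bool :=
  sel (allList F isBlock) (sel (allList X isBlock)
    ((fun A => next A 0 F (search n)) (exclude X (require F))) false) false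

/-! Relabellings: the image of the point `i` is stored in the `i`-th hexadecimal digit. -/

noncomputable def image (σ i : Nat) : Nat := Nat.land (Nat.shiftRight σ (Nat.mul 4 i)) 15

noncomputable def relabel (σ b : Nat) : Nat :=
  @Nat.rec (fun _ => Nat) 0 (fun i ih => Nat.lor ih (@Bool.rec (fun _ => Nat)
    (Nat.pow 2 (image σ i)) 0 (bitFree b i))) 14

noncomputable def isPerm (σ : Nat) : Bool :=
  sel (allBelow 14 fun i => Nat.blt (image σ i) 14) (Nat.beq (relabel σ 16383) 16383) false

end QuadrupleSearch

/-! ### Meaning of the bit operations. -/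

namespace QuadrupleSearch

theorem sel_eq_true {b x y : Bool} : sel b x y = true ↔ (b = true ∧ x = true) ∨ (b = false ∧ y = true) := by
  cases b <;> simp [sel]

theorem sel_false_eq_true {b x : Bool} : sel b x false = true ↔ b = true ∧ x = true := by
  cases b <;> simp [sel]

theorem sel_true_eq_true {b y : Bool} : sel b true y = true ↔ b = true ∨ y = true := by
  cases b <;> simp [sel]

theorem allBelow_eq_true {n : ℕ} {P : ℕ → Bool} : allBelow n P = true ↔ ∀ i < n, P i = true := by
  induction n with
  | zero => simp [allBelow]
  | succ n ih =>
    change sel (P n) (allBelow n P) false = true ↔ _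
    rw [sel_false_eq_true, ih]
    constructor
    · rintro ⟨h1, h2⟩ i hi
      rcases Nat.lt_succ_iff_lt_or_eq.1 hi with h | rfl
      · exact h2 i h
      · exact h1
    · exact fun h => ⟨h n n.lt_succ_self, fun i hi => h i (hi.trans n.lt_succ_self)⟩

theorem allList_eq_true {α : Type} {L : List α} {P : α → Bool} :
    allList L P = true ↔ ∀ b ∈ L, P b = true := by
  induction L with
  | nil => simp [allList]
  | cons b L ih =>
    change sel (P b) (allList L P) false = true ↔ _
    rw [sel_false_eq_true, ih, List.forall_mem_cons]

theorem anyList_eq_true {α : Type} {L : List α} {P : α → Bool} :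
    anyList L P = true ↔ ∃ b ∈ L, P b = true := by
  induction L with
  | nil => simp [anyList]
  | cons b L ih =>
    change sel (P b) true (anyList L P) = true ↔ _
    rw [sel_true_eq_true, ih, List.exists_mem_cons_iff]

theorem testBit_orList {L : List ℕ} {f : ℕ → ℕ} {q : ℕ} :
    (orList L f).testBit q = true ↔ ∃ b ∈ L, (f b).testBit q = true := by
  induction L with
  | nil => simp [orList]
  | cons b L ih =>
    change (f b ||| orList L f).testBit q = true ↔ _
    rw [Nat.testBit_lor, Bool.or_eq_true, ih, List.exists_mem_cons_iff]

theorem bitFree_eq_true {x i : ℕ} : bitFree x i = true ↔ x.testBit i = false := by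
  change Nat.beq ((x >>> i) &&& 1) 0 = true ↔ _
  rw [Nat.beq_eq, Nat.testBit, Nat.land_comm]
  simp

theorem bitFree_eq_false {x i : ℕ} : bitFree x i = false ↔ x.testBit i = true := by
  rw [← Bool.not_eq_true, bitFree_eq_true, Bool.not_eq_false]

/-- For odd `x`, passing to `x - 1` clears only bit 0; for `x = 2 * a` everything is shifted by one
from `a`. Soundness needs only that the result is some set bit, not that it is the lowest. -/
theorem low_eq {x : ℕ} (hx : x ≠ 0) : ∃ k, low x = 2 ^ k ∧ x.testBit k = true := by
  change ∃ k, x ^^^ (x &&& (x - 1)) = 2 ^ k ∧ _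
  induction x using Nat.strong_induction_on with
  | _ x ih =>
    rcases Nat.even_or_odd' x with ⟨a, rfl | rfl⟩
    · have ha : a ≠ 0 := by rintro rfl; exact hx rfl
      obtain ⟨k, hk, hk'⟩ := ih a (by omega) ha
      refine ⟨k + 1, ?_, ?_⟩
      · rw [pow_succ, ← hk]
        apply Nat.eq_of_testBit_eq
        intro i
        cases i with
        | zero => simp [Nat.testBit_zero]
        | succ i =>
          have h1 : (2 * a).testBit (i + 1) = a.testBit i := by
            rw [Nat.testBit_succ]; congr 1; omega
          have h2 : (2 * a - 1).testBit (i + 1) = (a - 1).testBit i := by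
            rw [Nat.testBit_succ]; congr 1; omega
          have h3 : ((a ^^^ (a &&& (a - 1))) * 2).testBit (i + 1)
              = (a ^^^ (a &&& (a - 1))).testBit i := by
            rw [Nat.testBit_succ]; congr 1; omega
          rw [h3]
          simp only [Nat.testBit_xor, Nat.testBit_land, h1, h2]
      · rw [Nat.testBit_succ, show 2 * a / 2 = a by omega]
        exact hk'
    · refine ⟨0, ?_, by simp⟩
      rw [show 2 * a + 1 - 1 = 2 * a by omega]
      apply Nat.eq_of_testBit_eq
      intro i
      rw [Nat.testBit_xor, Nat.testBit_land]
      cases i with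
      | zero => simp [Nat.testBit_zero]
      | succ i =>
        have h2 : (2 * a + 1).testBit (i + 1) = (2 * a).testBit (i + 1) := by
          rw [Nat.testBit_succ, Nat.testBit_succ]; congr 1; omega
        rw [h2, Nat.testBit_two_pow_of_ne (by omega)]
        simp

/-- The set of points with mask `c`. -/
def support (c : ℕ) : Finset (Fin 14) := Finset.univ.filter fun i => c.testBit i = true

@[simp] theorem mem_support {c : ℕ} {i : Fin 14} : i ∈ support c ↔ c.testBit i = true := by
  simp [support]

theorem support_land (a b : ℕ) : support (a &&& b) = support a ∩ support b := by
  ext i; simp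

theorem support_lor (a b : ℕ) : support (a ||| b) = support a ∪ support b := by
  ext i; simp

theorem testBit_eq_false_of_le {c i : ℕ} (hc : c < 2 ^ 14) (hi : 14 ≤ i) : c.testBit i = false :=
  Nat.testBit_eq_false_of_lt (hc.trans_le (Nat.pow_le_pow_right (by norm_num) hi))

theorem support_injOn {a b : ℕ} (ha : a < 2 ^ 14) (hb : b < 2 ^ 14) (h : support a = support b) :
    a = b := by
  apply Nat.eq_of_testBit_eq
  intro i
  by_cases hi : i < 14
  · have := Finset.ext_iff.1 h ⟨i, hi⟩
    simp only [mem_support] at this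
    exact Bool.eq_iff_iff.2 this
  · rw [testBit_eq_false_of_le ha (not_lt.1 hi), testBit_eq_false_of_le hb (not_lt.1 hi)]

/-- An injection from the `2 ^ 14` masks to the equally many subsets is onto. -/
theorem exists_support_eq (B : Finset (Fin 14)) : ∃ c < 2 ^ 14, support c = B := by
  have hinj : Function.Injective fun c : Fin (2 ^ 14) => support c := fun a b h =>
    Fin.ext (support_injOn a.2 b.2 h)
  obtain ⟨c, hc⟩ := ((Fintype.bijective_iff_injective_and_card _).2 ⟨hinj, by simp⟩).2 B
  exact ⟨c, c.2, hc⟩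

theorem card_support (c : ℕ) : (support c).card = pop c := by
  have h : ∀ i, (c >>> i) &&& 1 = if c.testBit i = true then 1 else 0 := by
    intro i
    rw [Nat.and_one_is_mod, Nat.testBit, Nat.land_comm, Nat.and_one_is_mod]
    rcases Nat.mod_two_eq_zero_or_one (c >>> i) with h | h <;> simp [h]
  have hs : ∀ n, @Nat.rec (fun _ => ℕ) 0 (fun i ih => Nat.add ih (Nat.land (Nat.shiftRight c i) 1)) n
      = ∑ i ∈ Finset.range n, if c.testBit i = true then 1 else 0 := by
    intro n
    induction n with
    | zero => rfl
    | succ n ih =>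
      rw [Finset.sum_range_succ, ← ih, ← h]
      rfl
  rw [support, Finset.card_filter, pop, hs, Finset.sum_range]

theorem support_two_pow {x : ℕ} (hx : x < 14) : support (2 ^ x) = {⟨x, hx⟩} := by
  ext i
  simp [Nat.testBit_two_pow, Fin.ext_iff, eq_comm]

end QuadrupleSearch

/-! ### Verification of the tables of triples, points and positions. -/

namespace QuadrupleSearch

noncomputable def checkBlock (c : ℕ) : Bool :=
  sel (Nat.beq (pop c) 4) (allList (positions c) fun q => sel (Nat.blt q 5096)
    (sel (Nat.beq (blockAt (Nat.pow 2 (Nat.mod q 364)) (Nat.pow 2 (Nat.mul 364 (Nat.div q 364)))) c)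
      (Nat.beq (Nat.land (Nat.shiftRight allPositions q) 1) 1) false) false) true

noncomputable def checkTriple (t : ℕ) : Bool :=
  (fun m => sel (Nat.beq (pop m) 3) (sel (Nat.blt m 16384) (allBelow 14 fun x =>
    sel (bitFree m x) (sel (Nat.beq (blockAt (Nat.pow 2 t) (Nat.pow 2 (Nat.mul 364 x)))
      (Nat.lor m (Nat.pow 2 x)))
        (anyList (positions (Nat.lor m (Nat.pow 2 x))) fun q => Nat.beq q (Nat.add t (Nat.mul 364 x)))
          false) true) false) false) (tripleMask (Nat.pow 2 t))

/-- All `2 ^ 14` masks are checked; the nesting `128 * 128` keeps the recursion shallow. -/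
theorem checkBlock_all : (allBelow 128 fun i => allBelow 128 fun j =>
    checkBlock (Nat.add (Nat.mul 128 i) j)) = true := by
  decide +kernel

theorem checkTriple_all : allBelow 364 checkTriple = true := by
  decide +kernel

theorem comb_testBit : (allBelow 14 fun x => Nat.beq
    (Nat.land (Nat.shiftRight comb (Nat.mul 364 x)) 1) 1) = true := by
  decide +kernel

theorem testBit_of_beq_one {A q : ℕ} (h : Nat.beq (Nat.land (Nat.shiftRight A q) 1) 1 = true) :
    A.testBit q = true := by
  rw [Nat.beq_eq] at h
  change A >>> q &&& 1 = 1 at h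
  rw [Nat.testBit, Nat.land_comm, h]
  rfl

theorem testBit_ones {n q : ℕ} (h : q < n) : (ones n).testBit q = true := by
  change (2 ^ n - 1).testBit q = true
  rw [Nat.testBit_two_pow_sub_one]
  simpa using h

theorem lt_of_ble_ones {n t : ℕ} (h : Nat.ble (2 ^ t) (ones n) = true) : t < n := by
  have h1 : 2 ^ t ≤ 2 ^ n - 1 := Nat.le_of_ble_eq_true h
  by_contra hcon
  have h2 : 2 ^ n ≤ 2 ^ t := Nat.pow_le_pow_right (by norm_num) (not_lt.1 hcon)
  have h3 : 0 < 2 ^ n := by positivity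
  omega

theorem checkBlock_of_lt {c : ℕ} (hc : c < 2 ^ 14) : checkBlock c = true := by
  have h := allBelow_eq_true.1 (allBelow_eq_true.1 checkBlock_all (c / 128) (by omega)) (c % 128)
    (by omega)
  have e : Nat.add (Nat.mul 128 (c / 128)) (c % 128) = c := Nat.div_add_mod c 128
  rwa [e] at h

theorem of_mem_positions {c q : ℕ} (hc : c < 2 ^ 14) (h4 : pop c = 4) (hq : q ∈ positions c) :
    q < 5096 ∧ blockAt (2 ^ (q % 364)) (2 ^ (364 * (q / 364))) = c
      ∧ allPositions.testBit q = true := by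
  have h := checkBlock_of_lt hc
  rw [checkBlock, h4] at h
  have h := allList_eq_true.1 h q hq
  rw [sel_false_eq_true, sel_false_eq_true] at h
  exact ⟨by simpa [Nat.blt] using h.1, Nat.eq_of_beq_eq_true h.2.1, testBit_of_beq_one h.2.2⟩

theorem testBit_positionMask {c q : ℕ} : (positionMask c).testBit q = true ↔ q ∈ positions c := by
  rw [positionMask, testBit_orList]
  constructor
  · rintro ⟨b, hb, h⟩
    change (2 ^ b).testBit q = true at h
    rw [Nat.testBit_two_pow, decide_eq_true_eq] at h
    exact h ▸ hb
  · intro h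
    refine ⟨q, h, ?_⟩
    change (2 ^ q).testBit q = true
    exact Nat.testBit_two_pow_self

theorem exists_mem_positions (c : ℕ) : ∃ q, q ∈ positions c := ⟨_, List.mem_cons_self ..⟩

/-- A position names a triple and a fourth point, hence the block itself. -/
theorem eq_of_testBit_positionMask {b c q : ℕ} (hb : b < 2 ^ 14) (hb4 : pop b = 4)
    (hc : c < 2 ^ 14) (hc4 : pop c = 4) (hbq : (positionMask b).testBit q = true)
    (hcq : (positionMask c).testBit q = true) : b = c := by
  rw [← (of_mem_positions hb hb4 (testBit_positionMask.1 hbq)).2.1,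
    (of_mem_positions hc hc4 (testBit_positionMask.1 hcq)).2.1]

theorem tripleMask_spec {t : ℕ} (ht : t < 364) :
    pop (tripleMask (2 ^ t)) = 3 ∧ tripleMask (2 ^ t) < 2 ^ 14 ∧
      ∀ x < 14, (tripleMask (2 ^ t)).testBit x = false →
        blockAt (2 ^ t) (2 ^ (364 * x)) = tripleMask (2 ^ t) ||| 2 ^ x ∧
        (positionMask (tripleMask (2 ^ t) ||| 2 ^ x)).testBit (t + 364 * x) = true := by
  have h := allBelow_eq_true.1 checkTriple_all t ht
  rw [checkTriple, sel_false_eq_true, sel_false_eq_true] at h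
  refine ⟨Nat.eq_of_beq_eq_true h.1, by simpa [Nat.blt] using h.2.1, fun x hx hxm => ?_⟩
  have h := allBelow_eq_true.1 h.2.2 x hx
  rw [sel_eq_true, bitFree_eq_true, bitFree_eq_false] at h
  rcases h with ⟨-, h⟩ | ⟨h, -⟩
  · rw [sel_false_eq_true, anyList_eq_true] at h
    obtain ⟨h1, q, hq, hqt⟩ := h
    refine ⟨Nat.eq_of_beq_eq_true h1, testBit_positionMask.2 ?_⟩
    rwa [Nat.eq_of_beq_eq_true hqt] at hq
  · exact absurd h (by rw [show (Nat.pow 2 t) = 2 ^ t from rfl, hxm]; simp)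

theorem testBit_comb {x : ℕ} (hx : x < 14) : comb.testBit (364 * x) = true :=
  testBit_of_beq_one (allBelow_eq_true.1 comb_testBit x hx)

/-! ### Systems of quadruples and the masks of their blocks -/

/-- Steiner quadruple systems on `Fin 14`. -/
structure IsSystem (𝓑 : Finset (Finset (Fin 14))) : Prop where
  card_block : ∀ B ∈ 𝓑, B.card = 4
  exists_block : ∀ T : Finset (Fin 14), T.card = 3 → ∃ B ∈ 𝓑, T ⊆ B
  eq_block : ∀ T : Finset (Fin 14), T.card = 3 → ∀ B ∈ 𝓑, ∀ C ∈ 𝓑, T ⊆ B → T ⊆ C → B = C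

/-- Some two disjoint blocks meet every block. -/
def HasDominatingPair {V : Type*} [DecidableEq V] (𝓑 : Finset (Finset V)) : Prop :=
  ∃ B ∈ 𝓑, ∃ C ∈ 𝓑, Disjoint B C ∧ ∀ D ∈ 𝓑, ¬ Disjoint D (B ∪ C)

def HasMask (𝓑 : Finset (Finset (Fin 14))) (c : ℕ) : Prop := c < 2 ^ 14 ∧ support c ∈ 𝓑

variable {𝓑 : Finset (Finset (Fin 14))}

theorem HasMask.pop_eq (h𝓑 : IsSystem 𝓑) {c : ℕ} (hc : HasMask 𝓑 c) : pop c = 4 := by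
  rw [← card_support]
  exact h𝓑.card_block _ hc.2

theorem lor_two_pow_lt {m x : ℕ} (hm : m < 2 ^ 14) (hx : x < 14) : m ||| 2 ^ x < 2 ^ 14 :=
  Nat.or_lt_two_pow hm (Nat.pow_lt_pow_right (by norm_num) hx)

theorem support_lor_two_pow {m x : ℕ} (hx : x < 14) :
    support (m ||| 2 ^ x) = insert ⟨x, hx⟩ (support m) := by
  rw [support_lor, support_two_pow hx, Finset.union_comm, Finset.insert_eq]

theorem pop_lor_two_pow {m x : ℕ} (hx : x < 14) (hmx : m.testBit x = false) :
    pop (m ||| 2 ^ x) = pop m + 1 := by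
  rw [← card_support, ← card_support, support_lor_two_pow hx, Finset.card_insert_of_notMem]
  simp [hmx]

/-- The block through a triple arises by adding a point. -/
theorem IsSystem.exists_hasMask (h𝓑 : IsSystem 𝓑) {m : ℕ} (hm : m < 2 ^ 14) (hm3 : pop m = 3) :
    ∃ x < 14, m.testBit x = false ∧ HasMask 𝓑 (m ||| 2 ^ x) := by
  obtain ⟨B, hB, hmB⟩ := h𝓑.exists_block (support m) (by rw [card_support, hm3])
  have h1 : (B \ support m).card = 1 := by
    rw [Finset.card_sdiff_of_subset hmB, h𝓑.card_block B hB, card_support, hm3]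
  obtain ⟨x, hx⟩ := Finset.card_eq_one.1 h1
  have hxm : x ∉ support m := (Finset.mem_sdiff.1 (hx ▸ Finset.mem_singleton_self x)).2
  refine ⟨x, x.2, by simpa using hxm, lor_two_pow_lt hm x.2, ?_⟩
  rw [support_lor_two_pow x.2]
  have : insert x (support m) = B := by
    rw [Finset.insert_eq, ← hx, Finset.sdiff_union_of_subset hmB]
  rwa [this]

theorem testBit_throughAux {q r : ℕ} (h : (throughAux q).testBit r = true) :
    ∃ x < 14, (q + 1).testBit x = false ∧ (positionMask ((q + 1) ||| 2 ^ x)).testBit r = true := by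
  have key : ∀ n, Nat.testBit (@Nat.rec (fun _ => Nat) 0 (fun x ih => Nat.lor ih
      (@Bool.rec (fun _ => Nat) 0 (positionMask (Nat.lor (Nat.succ q) (Nat.pow 2 x)))
        (bitFree (Nat.succ q) x))) n) r = true →
      ∃ x < n, (q + 1).testBit x = false ∧
        (positionMask ((q + 1) ||| 2 ^ x)).testBit r = true := by
    intro n
    induction n with
    | zero => intro h; simp at h
    | succ n ih =>
      intro h
      change Nat.testBit (_ ||| _) r = true at h
      rw [Nat.testBit_lor, Bool.or_eq_true] at h
      rcases h with h | h
      · obtain ⟨x, hx, h⟩ := ih h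
        exact ⟨x, hx.trans n.lt_succ_self, h⟩
      · cases hb : bitFree (Nat.succ q) n with
        | false => rw [hb] at h; simp at h
        | true =>
          rw [hb] at h
          exact ⟨n, n.lt_succ_self, bitFree_eq_true.1 hb, h⟩
  exact key 14 h

theorem testBit_through {m r : ℕ} (h : (through m).testBit r = true) :
    ∃ x < 14, m.testBit x = false ∧ (positionMask (m ||| 2 ^ x)).testBit r = true := by
  cases m with
  | zero => exact absurd h (by simp [through])
  | succ q =>
    change (0 ||| throughAux q).testBit r = true at h
    rw [Nat.zero_or] at h
    exact testBit_throughAux h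

/-- The passage from a block to its triples in `split4`. -/
theorem split4_spec {c : ℕ} (hc : c < 2 ^ 14) (h4 : pop c = 4) :
    ∃ i < 14, ∃ j < 14, ∃ k < 14, ∃ l < 14, c.testBit i = true ∧ c.testBit j = true ∧
      c.testBit k = true ∧ c.testBit l = true ∧
      ∀ (α : Type) (f : ℕ → ℕ → ℕ → ℕ → α), split4 c f = f (2 ^ i) (2 ^ j) (2 ^ k) (2 ^ l) := by
  have step : ∀ x n, x < 2 ^ 14 → pop x = n + 1 → ∃ i < 14, low x = 2 ^ i ∧ x.testBit i = true ∧
      x ^^^ 2 ^ i < 2 ^ 14 ∧ pop (x ^^^ 2 ^ i) = n ∧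
      ∀ j, (x ^^^ 2 ^ i).testBit j = true → x.testBit j = true := by
    intro x n hx hn
    have hx0 : x ≠ 0 := by
      rintro rfl
      rw [← card_support] at hn
      simp [support] at hn
    obtain ⟨i, hi, hxi⟩ := low_eq hx0
    have hi14 : i < 14 := by
      by_contra hcon
      rw [testBit_eq_false_of_le hx (not_lt.1 hcon)] at hxi
      exact absurd hxi (by simp)
    have hbit : ∀ j, (x ^^^ 2 ^ i).testBit j = (x.testBit j && !decide (i = j)) := by
      intro j
      rw [Nat.testBit_xor, Nat.testBit_two_pow]
      by_cases hij : i = j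
      · subst hij; simp [hxi]
      · simp [hij]
    refine ⟨i, hi14, hi, hxi, Nat.xor_lt_two_pow hx (Nat.pow_lt_pow_right (by norm_num) hi14),
      ?_, fun j hj => ?_⟩
    · rw [← card_support] at hn ⊢
      have : support (x ^^^ 2 ^ i) = (support x).erase ⟨i, hi14⟩ := by
        ext j
        simp only [mem_support, hbit, Finset.mem_erase, Fin.ext_iff, Bool.and_eq_true,
          Bool.not_eq_true', decide_eq_false_iff_not, ne_eq]
        tauto
      rw [this, Finset.card_erase_of_mem (by simpa using hxi), hn]
      rfl
    · rw [hbit] at hj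
      exact (Bool.and_eq_true _ _ ▸ hj).1
  obtain ⟨i, hi, hil, hci, hr, hr3, hrc⟩ := step c 3 hc h4
  obtain ⟨j, hj, hjl, hcj, hs, hs2, hsr⟩ := step _ 2 hr hr3
  obtain ⟨k, hk, hkl, hck, hu, hu1, hus⟩ := step _ 1 hs hs2
  obtain ⟨l, hl, hll, hcl, hw, hw0, -⟩ := step _ 0 hu hu1
  -- The fourth point is read off as what is left after three extractions; removing one more bit
  -- leaves the empty set.
  have hlast : c ^^^ 2 ^ i ^^^ 2 ^ j ^^^ 2 ^ k = 2 ^ l := by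
    have h0 : c ^^^ 2 ^ i ^^^ 2 ^ j ^^^ 2 ^ k ^^^ 2 ^ l = 0 := by
      apply support_injOn hw (by norm_num)
      rw [← card_support, Finset.card_eq_zero] at hw0
      rw [hw0]
      simp [support]
    exact Nat.xor_eq_zero_iff.1 h0
  refine ⟨i, hi, j, hj, k, hk, l, hl, hci, hrc _ hcj, hrc _ (hsr _ hck),
    hrc _ (hsr _ (hus _ hcl)), fun α f => ?_⟩
  change f (low c) (low (c ^^^ low c)) (low (c ^^^ low c ^^^ low (c ^^^ low c)))
    (c ^^^ low c ^^^ low (c ^^^ low c) ^^^ low (c ^^^ low c ^^^ low (c ^^^ low c))) = _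
  rw [hil, hjl, hkl, hlast]

/-- Choosing a block does not discard the other blocks of a system. -/
theorem testBit_keep (h𝓑 : IsSystem 𝓑) {b c q : ℕ} (hb : HasMask 𝓑 b) (hc : HasMask 𝓑 c)
    (hq : (positionMask c).testBit q = true) : (keep b).testBit q = true := by
  have hb4 := hb.pop_eq h𝓑
  have hc4 := hc.pop_eq h𝓑
  have hq5 := (of_mem_positions hc.1 hc4 (testBit_positionMask.1 hq)).1
  by_cases hbc : c = b
  · subst hbc
    change (_ ||| positionMask c).testBit q = true
    rw [Nat.testBit_lor, hq, Bool.or_true]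
  have hall : allBits.testBit q = true := by
    rw [allBits]
    exact testBit_ones (by omega)
  have hcov : (coveredMask b).testBit q = false := by
    change (_ <<< 5824).testBit q = false
    rw [Nat.testBit_shiftLeft]
    simp only [Bool.and_eq_false_imp, decide_eq_true_eq, ge_iff_le]
    omega
  -- A position in this mask belongs to a block through three points of `b`. If `c` had one,
  -- uniqueness of the block through a triple would give `c = b`.
  have hthr : ∀ i < 14, b.testBit i = true → (through (b ^^^ 2 ^ i)).testBit q = false := by
    intro i hi hbi
    by_contra hcon
    rw [Bool.not_eq_false] at hcon
    obtain ⟨x, hx, hmx, hpos⟩ := testBit_through hcon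
    have hbm : insert ⟨i, hi⟩ (support (b ^^^ 2 ^ i)) = support b := by
      ext j
      simp only [Finset.mem_insert, mem_support, Nat.testBit_xor, Nat.testBit_two_pow, Fin.ext_iff]
      by_cases hij : (j : ℕ) = i
      · simp [hij, hbi]
      · simp [hij, Ne.symm hij]
    have hmi : (⟨i, hi⟩ : Fin 14) ∉ support (b ^^^ 2 ^ i) := by
      simp [Nat.testBit_xor, hbi]
    have hm3 : (support (b ^^^ 2 ^ i)).card = 3 := by
      have := Finset.card_insert_of_notMem hmi
      rw [hbm, card_support, hb4] at this
      omega
    have hmlt : b ^^^ 2 ^ i < 2 ^ 14 :=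
      Nat.xor_lt_two_pow hb.1 (Nat.pow_lt_pow_right (by norm_num) hi)
    have hlt := lor_two_pow_lt hmlt hx
    have h4 : pop (b ^^^ 2 ^ i ||| 2 ^ x) = 4 := by
      rw [pop_lor_two_pow hx hmx, ← card_support, hm3]
    have hceq := eq_of_testBit_positionMask hc.1 hc4 hlt h4 hq hpos
    apply hbc
    apply support_injOn hc.1 hb.1
    apply h𝓑.eq_block _ hm3 _ hc.2 _ hb.2
    · rw [hceq, support_lor_two_pow hx]
      exact Finset.subset_insert _ _
    · rw [← hbm]
      exact Finset.subset_insert _ _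
  have hconf : (conflicts b).testBit q = false := by
    obtain ⟨i, hi, j, hj, k, hk, l, hl, hbi, hbj, hbk, hbl, hsp⟩ := split4_spec hb.1 hb4
    rw [conflicts, hsp]
    change ((through (b ^^^ 2 ^ i) ||| through (b ^^^ 2 ^ j))
      ||| (through (b ^^^ 2 ^ k) ||| through (b ^^^ 2 ^ l))).testBit q = false
    rw [Nat.testBit_lor, Nat.testBit_lor, Nat.testBit_lor, hthr i hi hbi, hthr j hj hbj,
      hthr k hk hbk, hthr l hl hbl]
    rfl
  change ((allBits ^^^ (conflicts b ||| coveredMask b)) ||| positionMask b).testBit q = true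
  rw [Nat.testBit_lor, Nat.testBit_xor, Nat.testBit_lor, hall, hconf, hcov]
  rfl

/-! ### Soundness of the search -/

/-- The state of the search admits the system: its blocks are available, and the chosen blocks are
among them. -/
structure Admits (𝓑 : Finset (Finset (Fin 14))) (A : ℕ) (L : List ℕ) : Prop where
  available : ∀ c, HasMask 𝓑 c → ∀ q, (positionMask c).testBit q = true → A.testBit q = true
  chosen : ∀ b ∈ L, HasMask 𝓑 b

theorem Admits.choose (h𝓑 : IsSystem 𝓑) {A b : ℕ} {L : List ℕ} (h : Admits 𝓑 A L)
    (hb : HasMask 𝓑 b) : Admits 𝓑 (A &&& keep b) (b :: L) where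
  available c hc q hq := by
    rw [Nat.testBit_land, h.available c hc q hq, testBit_keep h𝓑 hb hc hq]
    rfl
  chosen := List.forall_mem_cons.2 ⟨hb, h.chosen⟩

/-- Every block of the system is available, and at a leaf every available block is chosen. The
system therefore consists of the blocks in `L`, on which the pair was tested. -/
theorem leaf_sound (h𝓑 : IsSystem 𝓑) {A : ℕ} {L : List ℕ} (hA : Admits 𝓑 A L)
    (h : leaf A L = true) : HasDominatingPair 𝓑 := by
  rw [leaf, sel_false_eq_true, anyList_eq_true] at h
  obtain ⟨hAL, b, hb, h⟩ := h
  obtain ⟨c, hc, h⟩ := anyList_eq_true.1 h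
  rw [sel_false_eq_true, allList_eq_true] at h
  obtain ⟨hbc, h⟩ := h
  have hAL : A &&& positionBits = orList L positionMask := Nat.eq_of_beq_eq_true hAL
  have hmem : ∀ e, HasMask 𝓑 e → e ∈ L := by
    intro e he
    obtain ⟨q, hq⟩ := exists_mem_positions e
    have hq5 := (of_mem_positions he.1 (he.pop_eq h𝓑) hq).1
    have hq := testBit_positionMask.2 hq
    have : (A &&& positionBits).testBit q = true := by
      rw [Nat.testBit_land, hA.available e he q hq, positionBits, testBit_ones hq5]
      rfl
    rw [hAL, testBit_orList] at this
    obtain ⟨d, hd, hdq⟩ := this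
    have hd' := hA.chosen d hd
    rwa [eq_of_testBit_positionMask he.1 (he.pop_eq h𝓑) hd'.1 (hd'.pop_eq h𝓑) hq hdq]
  have hzero : ∀ {a d : ℕ}, a < 2 ^ 14 → (Disjoint (support a) (support d) ↔ a &&& d = 0) := by
    intro a d ha
    rw [Finset.disjoint_iff_inter_eq_empty, ← support_land]
    constructor
    · intro h0
      apply support_injOn (lt_of_le_of_lt Nat.and_le_left ha) (by norm_num)
      rw [h0]
      simp [support]
    · intro h0
      rw [h0]
      simp [support]
  refine ⟨support b, (hA.chosen b hb).2, support c, (hA.chosen c hc).2,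
    (hzero (hA.chosen b hb).1).2 (Nat.eq_of_beq_eq_true hbc), fun D hD hdisj => ?_⟩
  obtain ⟨e, he, rfl⟩ := exists_support_eq D
  rw [← support_lor, hzero he] at hdisj
  have hh := h e (hmem e ⟨he, hD⟩)
  have h0 : Nat.beq (Nat.land e (Nat.lor b c)) 0 = true := by
    rw [Nat.beq_eq]
    exact hdisj
  rw [h0] at hh
  exact absurd hh (by simp)

/-- The system has a block at one of the options `y` for the triple of rank `t`. -/
def HasOption (𝓑 : Finset (Finset (Fin 14))) (t y : ℕ) : Prop :=
  ∃ x < 14, (tripleMask (2 ^ t)).testBit x = false ∧ HasMask 𝓑 (tripleMask (2 ^ t) ||| 2 ^ x) ∧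
    y.testBit (364 * x) = true

def SoundStep (𝓑 : Finset (Finset (Fin 14))) (k : Step) : Prop :=
  ∀ A L f t y, t < 364 → Admits 𝓑 A L → HasOption 𝓑 t y → k A L f (2 ^ t) y = true →
    HasDominatingPair 𝓑

/-- Any triple may be branched on, because the system has a block through it. Its available
positions are spaced 364 bits apart; dividing by `2 ^ t` aligns them with `comb`. -/
theorem pick_sound (h𝓑 : IsSystem 𝓑) {A f : ℕ} {L : List ℕ} {k : Step} (hk : SoundStep 𝓑 k)
    (hA : Admits 𝓑 A L) (hf : f ≠ 0) (h : pick A f L k = true) : HasDominatingPair 𝓑 := by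
  obtain ⟨t, ht, -⟩ := low_eq hf
  rw [pick, ht, sel_false_eq_true] at h
  have ht364 : t < 364 := lt_of_ble_ones h.1
  obtain ⟨h3, hlt, hspec⟩ := tripleMask_spec ht364
  obtain ⟨x, hx, hmx, hmask⟩ := h𝓑.exists_hasMask hlt h3
  refine hk A L f t _ ht364 hA ⟨x, hx, hmx, hmask, ?_⟩ h.2
  change (A / 2 ^ t &&& comb).testBit (364 * x) = true
  rw [Nat.testBit_land, testBit_comb hx, Nat.testBit_div_two_pow, Bool.and_true, add_comm]
  exact hA.available _ hmask _ (hspec x hx hmx).2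

theorem next_sound (h𝓑 : IsSystem 𝓑) {A f : ℕ} {L : List ℕ} {k : Step} (hk : SoundStep 𝓑 k)
    (hA : Admits 𝓑 A L) (h : next A f L k = true) : HasDominatingPair 𝓑 := by
  rw [next, sel_eq_true] at h
  rcases h with ⟨-, h⟩ | ⟨h0, h⟩
  · rw [sel_eq_true] at h
    rcases h with ⟨-, h⟩ | ⟨h0, h⟩
    · exact leaf_sound h𝓑 hA h
    · exact pick_sound h𝓑 hk hA (Nat.ne_of_beq_eq_false h0) h
  · exact pick_sound h𝓑 hk hA (Nat.ne_of_beq_eq_false h0) h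

theorem search_sound (h𝓑 : IsSystem 𝓑) (n : ℕ) : SoundStep 𝓑 (search n) := by
  induction n with
  | zero => exact fun A L f t y _ _ _ h => absurd h (by simp [search])
  | succ n ih =>
    intro A L f t y ht hA hy h
    change sel (Nat.beq y 0) true (@Nat.rec (fun _ => Bool) false (fun q _ =>
        sel (next (A &&& keep (q + 1)) (f &&& ((A &&& keep (q + 1)) >>> 5824)) ((q + 1) :: L)
          (search n)) (search n A L f (2 ^ t) (y ^^^ low y)) false)
        (blockAt (2 ^ t) (low y))) = true at h
    obtain ⟨x, hx, hmx, hmask, hyx⟩ := hy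
    have hy0 : y ≠ 0 := by
      rintro rfl
      simp at hyx
    obtain ⟨j, hj, hyj⟩ := low_eq hy0
    have hbeq : Nat.beq y 0 = false := by
      rw [← Bool.not_eq_true, Nat.beq_eq]
      exact hy0
    rw [hbeq, hj] at h
    cases hb : blockAt (2 ^ t) (2 ^ j) with
    | zero =>
      rw [hb] at h
      exact absurd h (by simp)
    | succ q =>
      rw [hb] at h
      change sel (next (A &&& keep (q + 1)) (f &&& ((A &&& keep (q + 1)) >>> 5824)) ((q + 1) :: L)
          (search n)) (search n A L f (2 ^ t) (y ^^^ 2 ^ j)) false = true at h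
      rw [sel_false_eq_true] at h
      -- If the option tried is the block of the system, the new state still admits the system;
      -- otherwise that block is among the remaining options.
      by_cases hjx : j = 364 * x
      · subst hjx
        rw [((tripleMask_spec ht).2.2 x hx hmx).1] at hb
        rw [hb] at hmask
        exact next_sound h𝓑 ih (hA.choose h𝓑 hmask) h.1
      · refine ih A L f t _ ht hA ⟨x, hx, hmx, hmask, ?_⟩ h.2
        rw [Nat.testBit_xor, Nat.testBit_two_pow_of_ne hjx, hyx]
        rfl

theorem isBlock_eq_true {c : ℕ} : isBlock c = true ↔ c < 2 ^ 14 ∧ pop c = 4 := by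
  rw [isBlock, sel_false_eq_true, Nat.beq_eq]
  simp [Nat.blt]

theorem admits_require (h𝓑 : IsSystem 𝓑) {F : List ℕ} (hF : ∀ f ∈ F, HasMask 𝓑 f) :
    Admits 𝓑 (require F) F := by
  induction F with
  | nil =>
    exact ⟨fun c hc q hq =>
      (of_mem_positions hc.1 (hc.pop_eq h𝓑) (testBit_positionMask.1 hq)).2.2, by simp⟩
  | cons b F ih =>
    rw [List.forall_mem_cons] at hF
    exact (ih hF.2).choose h𝓑 hF.1

theorem admits_exclude (h𝓑 : IsSystem 𝓑) {A : ℕ} {L X : List ℕ} (hA : Admits 𝓑 A L)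
    (hX : ∀ x ∈ X, isBlock x = true ∧ ¬ HasMask 𝓑 x) : Admits 𝓑 (exclude X A) L := by
  induction X with
  | nil => exact hA
  | cons x X ih =>
    rw [List.forall_mem_cons] at hX
    refine ⟨fun c hc q hq => ?_, hA.chosen⟩
    have h1 := (ih hX.2).available c hc q hq
    have h2 : (positionMask x).testBit q = false := by
      by_contra hcon
      rw [Bool.not_eq_false] at hcon
      obtain ⟨hx, hx4⟩ := isBlock_eq_true.1 hX.1.1
      exact hX.1.2 (eq_of_testBit_positionMask hc.1 (hc.pop_eq h𝓑) hx hx4 hq hcon ▸ hc)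
    change (exclude X A ^^^ (exclude X A &&& positionMask x)).testBit q = true
    rw [Nat.testBit_xor, Nat.testBit_land, h1, h2]
    rfl

theorem run_sound (h𝓑 : IsSystem 𝓑) {n : ℕ} {F X : List ℕ} (hF : ∀ f ∈ F, support f ∈ 𝓑)
    (hX : ∀ x ∈ X, support x ∉ 𝓑) (h : run n F X = true) : HasDominatingPair 𝓑 := by
  rw [run, sel_false_eq_true, sel_false_eq_true, allList_eq_true, allList_eq_true] at h
  refine next_sound h𝓑 (search_sound h𝓑 n) (admits_exclude h𝓑 (admits_require h𝓑 fun f hf =>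
    ⟨(isBlock_eq_true.1 (h.1 f hf)).1, hF f hf⟩) fun x hx => ⟨h.2.1 x hx, fun hc => hX x hx hc.2⟩)
    h.2.2

end QuadrupleSearch

/-! ### Transport of systems along bijections -/

/-- The image of a family of sets under a bijection. -/
def transport {V W : Type*} (e : V ≃ W) (𝓑 : Finset (Finset V)) : Finset (Finset W) :=
  𝓑.map e.finsetCongr.toEmbedding

theorem mem_transport {V W : Type*} {e : V ≃ W} {𝓑 : Finset (Finset V)} {C : Finset W} :
    C ∈ transport e 𝓑 ↔ C.map e.symm.toEmbedding ∈ 𝓑 := by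
  rw [transport, Finset.mem_map_equiv]
  rfl

theorem map_mem_transport {V W : Type*} {e : V ≃ W} {𝓑 : Finset (Finset V)} {B : Finset V} :
    B.map e.toEmbedding ∈ transport e 𝓑 ↔ B ∈ 𝓑 :=
  Finset.mem_map' e.finsetCongr.toEmbedding

namespace QuadrupleSearch

theorem HasDominatingPair.of_transport {V W : Type*} [DecidableEq V] [DecidableEq W] (e : V ≃ W)
    {𝓑 : Finset (Finset V)} (h : HasDominatingPair (transport e 𝓑)) : HasDominatingPair 𝓑 := by
  obtain ⟨B, hB, C, hC, hBC, h⟩ := h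
  refine ⟨_, mem_transport.1 hB, _, mem_transport.1 hC, Finset.disjoint_map _ |>.2 hBC,
    fun D hD hdisj => h _ (map_mem_transport.2 hD) ?_⟩
  rw [← Finset.map_union, ← Finset.disjoint_map e.toEmbedding, Finset.map_map] at hdisj
  simpa using hdisj

theorem IsSystem.transport {𝓑 : Finset (Finset (Fin 14))} (h𝓑 : IsSystem 𝓑)
    (e : Equiv.Perm (Fin 14)) : IsSystem (transport e 𝓑) where
  card_block B hB := by
    rw [← Finset.card_map e.symm.toEmbedding]
    exact h𝓑.card_block _ (mem_transport.1 hB)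
  exists_block T hT := by
    obtain ⟨B, hB, hTB⟩ := h𝓑.exists_block (T.map e.symm.toEmbedding) (by rw [Finset.card_map, hT])
    refine ⟨_, map_mem_transport.2 hB, ?_⟩
    have := Finset.map_subset_map (f := e.toEmbedding) |>.2 hTB
    rw [Finset.map_map] at this
    simpa using this
  eq_block T hT B hB C hC hTB hTC := by
    have := h𝓑.eq_block (T.map e.symm.toEmbedding) (by rw [Finset.card_map, hT]) _
      (mem_transport.1 hB) _ (mem_transport.1 hC) (Finset.map_subset_map.2 hTB)
      (Finset.map_subset_map.2 hTC)
    exact Finset.map_injective _ this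

theorem testBit_relabel {σ b y : ℕ} : (relabel σ b).testBit y = true ↔
    ∃ i < 14, b.testBit i = true ∧ image σ i = y := by
  have key : ∀ n, Nat.testBit (@Nat.rec (fun _ => Nat) 0 (fun i ih => Nat.lor ih
      (@Bool.rec (fun _ => Nat) (Nat.pow 2 (image σ i)) 0 (bitFree b i))) n) y = true ↔
      ∃ i < n, b.testBit i = true ∧ image σ i = y := by
    intro n
    induction n with
    | zero => simp
    | succ n ih =>
      change Nat.testBit (_ ||| _) y = true ↔ _
      rw [Nat.testBit_lor, Bool.or_eq_true, ih]
      have h1 : Nat.testBit (@Bool.rec (fun _ => Nat) (Nat.pow 2 (image σ n)) 0 (bitFree b n)) y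
          = true ↔ b.testBit n = true ∧ image σ n = y := by
        cases hb : bitFree b n with
        | false =>
          rw [bitFree_eq_false] at hb
          change (2 ^ image σ n).testBit y = true ↔ _
          simp [Nat.testBit_two_pow, hb]
        | true =>
          rw [bitFree_eq_true] at hb
          simp [hb]
      rw [h1]
      constructor
      · rintro (⟨i, hi, h⟩ | h)
        · exact ⟨i, by omega, h⟩
        · exact ⟨n, by omega, h⟩
      · rintro ⟨i, hi, h⟩
        rcases Nat.lt_succ_iff_lt_or_eq.1 hi with hi | rfl
        · exact Or.inl ⟨i, hi, h⟩
        · exact Or.inr h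
  exact key 14

/-- The full mask being its own image makes the map onto, and a surjection of a finite set to itself
is bijective. -/
theorem exists_perm {σ : ℕ} (hσ : isPerm σ = true) : ∃ e : Equiv.Perm (Fin 14),
    ∀ b, support (relabel σ b) = (support b).map e.toEmbedding := by
  rw [isPerm, sel_false_eq_true, allBelow_eq_true] at hσ
  obtain ⟨hlt, hall⟩ := hσ
  have hall : relabel σ 16383 = 16383 := Nat.eq_of_beq_eq_true hall
  let g : Fin 14 → Fin 14 := fun i => ⟨image σ i, by simpa [Nat.blt] using hlt i i.2⟩
  have hg : Function.Bijective g := by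
    rw [← Finite.surjective_iff_bijective]
    intro y
    have : (relabel σ 16383).testBit y = true := by
      rw [hall, show 16383 = 2 ^ 14 - 1 from rfl, Nat.testBit_two_pow_sub_one]
      simp
    obtain ⟨i, hi, -, h⟩ := testBit_relabel.1 this
    exact ⟨⟨i, hi⟩, Fin.ext h⟩
  refine ⟨Equiv.ofBijective g hg, fun b => ?_⟩
  ext y
  rw [mem_support, testBit_relabel, Finset.mem_map]
  constructor
  · rintro ⟨i, hi, hb, h⟩
    exact ⟨⟨i, hi⟩, mem_support.2 hb, Fin.ext h⟩
  · rintro ⟨i, hi, h⟩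
    exact ⟨i, i.2, mem_support.1 hi, congrArg Fin.val h⟩

/-! ### Reductions between partial systems -/

/-- All systems containing the blocks `F` and none of the blocks `X` have a dominating pair. -/
def Resolved (F X : List ℕ) : Prop :=
  ∀ 𝓑, IsSystem 𝓑 → (∀ f ∈ F, support f ∈ 𝓑) → (∀ x ∈ X, support x ∉ 𝓑) → HasDominatingPair 𝓑

/-- All systems containing the blocks `F` and one of the blocks `X` have a dominating pair. -/
def Caught (F X : List ℕ) : Prop :=
  ∀ 𝓑, IsSystem 𝓑 → (∀ f ∈ F, support f ∈ 𝓑) → (∃ x ∈ X, support x ∈ 𝓑) → HasDominatingPair 𝓑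

theorem resolved_of_run {n : ℕ} {F X : List ℕ} (h : run n F X = true) : Resolved F X :=
  fun _ h𝓑 hF hX => run_sound h𝓑 hF hX h

theorem caught_nil (F : List ℕ) : Caught F [] := by
  rintro 𝓑 - - ⟨x, hx, -⟩
  exact absurd hx (by simp)

theorem Resolved.of_caught {F X : List ℕ} (h : Resolved F X) (hc : Caught F X) :
    Resolved F [] := by
  intro 𝓑 h𝓑 hF _
  by_cases hX : ∃ x ∈ X, support x ∈ 𝓑
  · exact hc 𝓑 h𝓑 hF hX
  · push Not at hX
    exact h 𝓑 h𝓑 hF hX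

/-- Every member of `F'` is the image under `σ` of a member of `F`. -/
noncomputable def covers (σ : ℕ) (F F' : List ℕ) : Bool :=
  allList F' fun g => anyList F fun f => Nat.beq (relabel σ f) g

theorem covers_spec {σ : ℕ} {F F' : List ℕ} (h : covers σ F F' = true) :
    ∀ g ∈ F', ∃ f ∈ F, relabel σ f = g := by
  intro g hg
  obtain ⟨f, hf, h⟩ := anyList_eq_true.1 (allList_eq_true.1 h g hg)
  exact ⟨f, hf, Nat.eq_of_beq_eq_true h⟩

/-- A system with `F` and without `X` is carried by `σ` to one with `F'` and without `X'`; for this,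
`F'` and `X'` need only be contained in the images. Relabelling also changes which bits are lowest,
and so the course of a search. -/
theorem Resolved.relabel {σ : ℕ} {F X F' X' : List ℕ} (h : Resolved F' X')
    (hσ : isPerm σ = true) (hF : covers σ F F' = true) (hX : covers σ X X' = true) :
    Resolved F X := by
  intro 𝓑 h𝓑 hF𝓑 hX𝓑
  obtain ⟨e, he⟩ := exists_perm hσ
  refine HasDominatingPair.of_transport e (h _ (h𝓑.transport e) (fun g hg => ?_) fun g hg => ?_)
  · obtain ⟨f, hf, rfl⟩ := covers_spec hF g hg
    rw [he, map_mem_transport]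
    exact hF𝓑 f hf
  · obtain ⟨x, hx, rfl⟩ := covers_spec hX g hg
    rw [he, map_mem_transport]
    exact hX𝓑 x hx

/-- The images of `b` under the relabellings `A`. -/
noncomputable def orbit (A : List ℕ) (b : ℕ) : List ℕ := A.map fun a => relabel a b

/-- The members of `A` are relabellings that preserve `F`. -/
noncomputable def stabilize (A F : List ℕ) : Bool :=
  allList A fun a => sel (isPerm a) (allList F fun f => anyList F fun g =>
    Nat.beq (relabel a f) g) false

/-- A system containing an image of `b` under a symmetry of `F` is carried back to one containing
`b` and `F`. That one either contains a member of `X`, which `hc` settles, or avoids `X`, which `h`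
settles. Orbits can thus be excluded one after another. -/
theorem Caught.orbit_append {A F X : List ℕ} {b : ℕ} (hc : Caught F X) (hA : stabilize A F = true)
    (h : Resolved (b :: F) X) : Caught F (orbit A b ++ X) := by
  rintro 𝓑 h𝓑 hF ⟨x, hx, hx𝓑⟩
  rw [List.mem_append] at hx
  rcases hx with hx | hx
  · obtain ⟨a, ha, rfl⟩ := List.mem_map.1 hx
    have h1 := allList_eq_true.1 hA a ha
    rw [sel_false_eq_true, allList_eq_true] at h1
    obtain ⟨e, he⟩ := exists_perm h1.1
    have hmem : ∀ c, support c ∈ transport e.symm 𝓑 ↔ support (relabel a c) ∈ 𝓑 := fun c => by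
      rw [he, mem_transport]
      rfl
    have hF' : ∀ f ∈ F, support f ∈ transport e.symm 𝓑 := fun f hf => by
      rw [hmem]
      obtain ⟨g, hg, hfg⟩ := anyList_eq_true.1 (h1.2 f hf)
      rw [Nat.eq_of_beq_eq_true hfg]
      exact hF g hg
    apply HasDominatingPair.of_transport e.symm
    by_cases hX : ∃ x ∈ X, support x ∈ transport e.symm 𝓑
    · exact hc _ (h𝓑.transport _) hF' hX
    · push Not at hX
      exact h _ (h𝓑.transport _) (List.forall_mem_cons.2 ⟨(hmem b).2 hx𝓑, hF'⟩) hX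
  · exact hc 𝓑 h𝓑 hF ⟨x, hx, hx𝓑⟩

/-! ### Branching on the block through a triple -/

/-- Evaluates `P` at the `i`-th member of a list. -/
noncomputable def atEntry (R : List (List ℕ)) (i : ℕ) (P : List ℕ → Bool) : Bool :=
  @List.rec (List ℕ) (fun _ => ℕ → Bool) (fun _ => false)
    (fun F _ ih i => @Nat.rec (fun _ => Bool) (P F) (fun j _ => ih j) i) R i

theorem atEntry_spec {R : List (List ℕ)} {i : ℕ} {P : List ℕ → Bool} (h : atEntry R i P = true) :
    ∃ F ∈ R, P F = true := by
  induction R generalizing i with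
  | nil => exact absurd h (by simp [atEntry])
  | cons F R ih =>
    cases i with
    | zero => exact ⟨F, List.mem_cons_self .., h⟩
    | succ i =>
      obtain ⟨G, hG, h⟩ := ih (i := i) h
      exact ⟨G, List.mem_cons_of_mem _ hG, h⟩

/-- A branching: a point `x` completing the triple in question, a relabelling, and the index of an
already resolved list of blocks. -/
structure Branch where
  point : ℕ
  relabelling : ℕ
  index : ℕ

/-- A list of blocks, a triple, and the branchings over the blocks through that triple. -/
structure Node where
  blocks : List ℕ
  triple : ℕ
  branches : List Branch

noncomputable def checkPoint (R : List (List ℕ)) (N : Node) (x : ℕ) : Bool :=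
  sel (bitFree N.triple x)
    (sel (anyList N.blocks fun f => Nat.beq (pop (Nat.land f (Nat.lor N.triple (Nat.pow 2 x)))) 3)
      true (anyList N.branches fun K => sel (Nat.beq K.point x) (sel (isPerm K.relabelling)
        (atEntry R K.index fun F => covers K.relabelling
          (Nat.lor N.triple (Nat.pow 2 x) :: N.blocks) F) false) false)) true

noncomputable def checkNode (R : List (List ℕ)) (N : Node) : Bool :=
  sel (Nat.blt N.triple 16384) (sel (Nat.beq (pop N.triple) 3) (allBelow 14 (checkPoint R N)) false)
    false

/-- Every node verified joins the front of the resolved lists, so branch indices count backwards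
from the latest node. Children precede parents, and the last node must be the empty list. -/
noncomputable def checkTree (T : List Node) (R : List (List ℕ)) : Bool :=
  @List.rec Node (fun _ => List (List ℕ) → Bool)
    (fun R => atEntry R 0 (@List.rec ℕ (fun _ => Bool) true fun _ _ _ => false))
    (fun N _ ih R => sel (checkNode R N) (ih (N.blocks :: R)) false) T R

/-- The system has a block through the triple. Either it would share exactly three points with a
block already present, which is impossible, or adding it gives a list that contains a resolved one
up to relabelling. -/
theorem checkNode_sound {R : List (List ℕ)} (hR : ∀ F ∈ R, Resolved F []) {N : Node}
    (h : checkNode R N = true) : Resolved N.blocks [] := by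
  rw [checkNode, sel_false_eq_true, sel_false_eq_true, allBelow_eq_true] at h
  obtain ⟨hlt, h3, h⟩ := h
  intro 𝓑 h𝓑 hF hX
  obtain ⟨x, hx, hmx, hmask⟩ := h𝓑.exists_hasMask (m := N.triple) (by simpa [Nat.blt] using hlt)
    (Nat.eq_of_beq_eq_true h3)
  have h := h x hx
  rw [checkPoint, bitFree_eq_true.2 hmx] at h
  have h : sel _ _ _ = true := h
  rw [sel_true_eq_true] at h
  rcases h with h | h
  · obtain ⟨f, hf, hfx⟩ := anyList_eq_true.1 h
    have hfx : pop (f &&& (N.triple ||| 2 ^ x)) = 3 := Nat.eq_of_beq_eq_true hfx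
    rw [← card_support, support_land] at hfx
    have heq := h𝓑.eq_block _ hfx _ (hF f hf) _ hmask.2 Finset.inter_subset_left
      Finset.inter_subset_right
    rw [heq, Finset.inter_self, h𝓑.card_block _ hmask.2] at hfx
    exact absurd hfx (by norm_num)
  · obtain ⟨K, -, hK⟩ := anyList_eq_true.1 h
    rw [sel_false_eq_true, sel_false_eq_true] at hK
    obtain ⟨hKx, hσ, hK⟩ := hK
    obtain ⟨F, hFR, hcov⟩ := atEntry_spec hK
    exact (hR F hFR).relabel hσ hcov (X := []) rfl 𝓑 h𝓑
      (List.forall_mem_cons.2 ⟨hmask.2, hF⟩) (by simp)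

theorem checkTree_sound {T : List Node} {R : List (List ℕ)} (hR : ∀ F ∈ R, Resolved F [])
    (h : checkTree T R = true) : Resolved [] [] := by
  induction T generalizing R with
  | nil =>
    obtain ⟨F, hF, h⟩ := atEntry_spec (R := R) h
    cases F with
    | nil => exact hR _ hF
    | cons b F => exact absurd h (by simp)
  | cons N T ih =>
    have h : sel (checkNode R N) (checkTree T (N.blocks :: R)) false = true := h
    rw [sel_false_eq_true] at h
    exact ih (List.forall_mem_cons.2 ⟨checkNode_sound hR h.1, hR⟩) h.2

end QuadrupleSearch

/-! ### The two Steiner triple systems on thirteen points -/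

namespace QuadrupleSearch

/-- The blocks of a quadruple system through its last point, for the cyclic Steiner triple system. -/
def cyclic : List ℕ :=
  [8211, 8325, 12297, 10273, 8513, 9729, 8230, 8458, 12354, 8834, 11266, 8268, 8724, 9476, 14340,
  8344, 9256, 10760, 8496, 10320, 13328, 8800, 12448, 9408, 10624, 13056]

/-- Relabellings that preserve `cyclic`. -/
def cyclicSymmetries : List ℕ :=
  [0xdcba9876543210, 0xda741b852c9630, 0xd48c37b26a1590, 0xd0cba987654321, 0xdb852c9630a741,
  0xd59048c37b26a1, 0xd10cba98765432, 0xdc9630a741b852, 0xd6a159048c37b2, 0xd210cba9876543,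
  0xd0a741b852c963, 0xd7b26a159048c3, 0xd8c37b26a15904, 0xd3210cba987654, 0xd1b852c9630a74,
  0xd9048c37b26a15, 0xd43210cba98765, 0xd2c9630a741b85, 0xda159048c37b26, 0xd543210cba9876,
  0xd30a741b852c96, 0xdb26a159048c37, 0xd6543210cba987, 0xd41b852c9630a7, 0xdc37b26a159048,
  0xd76543210cba98, 0xd52c9630a741b8, 0xd048c37b26a159, 0xd876543210cba9, 0xd630a741b852c9,
  0xd741b852c9630a, 0xd159048c37b26a, 0xd9876543210cba, 0xd852c9630a741b, 0xd26a159048c37b,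
  0xda9876543210cb, 0xdba9876543210c, 0xd9630a741b852c, 0xd37b26a159048c]

theorem stabilize_cyclic : stabilize cyclicSymmetries cyclic = true := by decide +kernel

/-- Representatives of orbits of quadruples under `cyclicSymmetries`; the systems meeting an orbit
are treated in turn, from the last orbit to the first. -/
def cyclicQuadruples : List ℕ := [6672, 4448, 113]

/-- As in the other cases with a representative, the relabelling fixes the last point and moves the
representative to 7680, the mask of `{9, 10, 11, 12}`. The number 4000 only bounds the recursion. -/
theorem resolved_cyclic_with_113 : Resolved (113 :: cyclic)
    [] :=
  Resolved.relabel (σ := 0xd326718bac4509) (resolved_of_run (n := 4000)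
    (F :=
      [7680, 12801, 8992, 8728, 9732, 10754, 8896, 9249, 8211, 10249, 8577, 8261, 10288, 12448,
      8290, 8236, 12560, 9296, 8340, 13314, 14340, 12360, 11392, 9480, 10560, 8454, 8330])
    (X :=
      [])
    (by decide +kernel)) (by decide +kernel) (by decide +kernel) (by decide +kernel)

theorem resolved_cyclic_with_4448 : Resolved (4448 :: cyclic)
    ((cyclicQuadruples.drop 2).flatMap (orbit cyclicSymmetries)) :=
  Resolved.relabel (σ := 0xdb672a39c45801) (resolved_of_run (n := 4000)
    (F :=
      [7680, 8211, 8458, 10274, 12354, 9730, 8326, 12545, 9249, 10753, 8205, 8385, 8992, 8468,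
      9600, 10560, 8248, 12448, 8292, 13328, 8784, 10384, 12804, 14344, 8840, 9288, 11268])
    (X :=
      [30, 105, 226, 263, 281, 368, 417, 547, 564, 657, 836, 898, 1068, 1093, 1106, 1162, 1172,
      1800, 2122, 2129, 2216, 2436, 2572, 2752, 3075, 3344, 3616, 4134, 4248, 4292, 4424, 4617,
      4626, 5249, 5408, 5696, 6149, 6192, 6402])
    (by decide +kernel)) (by decide +kernel) (by decide +kernel) (by decide +kernel)

theorem resolved_cyclic_with_6672 : Resolved (6672 :: cyclic)
    ((cyclicQuadruples.drop 1).flatMap (orbit cyclicSymmetries)) :=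
  Resolved.relabel (σ := 0xd9c7a8425b1036) (resolved_of_run (n := 4000)
    (F :=
      [7680, 10312, 8273, 8770, 12384, 8516, 9408, 8233, 8458, 8716, 9240, 12424, 8199, 11265,
      8577, 12801, 10258, 8354, 13314, 10528, 14340, 10880, 9252, 8752, 8340, 12560, 9984])
    (X :=
      [46, 60, 78, 90, 139, 147, 197, 228, 277, 291, 306, 360, 408, 424, 464, 581, 609, 649, 658,
      774, 785, 804, 840, 960, 1037, 1059, 1097, 1108, 1122, 1200, 1298, 1346, 1556, 1576, 1665,
      1666, 2069, 2073, 2145, 2148, 2182, 2188, 2224, 2313, 2570, 2594, 2640, 2817, 3078, 3152,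
      3208, 3332, 3456, 3616, 4122, 4124, 4145, 4163, 4257, 4290, 4388, 4484, 4614, 4648, 4688,
      4740, 5125, 5192, 5280, 5377, 5384, 5648, 6147, 6192, 6336, 6402, 6464, 6664])
    (by decide +kernel)) (by decide +kernel) (by decide +kernel) (by decide +kernel)

/-- The remaining case: no quadruple of any chosen orbit is a block. -/
theorem resolved_cyclic_rest : Resolved cyclic
    (cyclicQuadruples.flatMap (orbit cyclicSymmetries)) :=
  Resolved.relabel (σ := 0xdc7b8351a69402) (resolved_of_run (n := 4000)
    (F :=
      [8261, 8244, 12804, 9348, 8206, 10500, 9233, 8713, 12291, 8481, 10369, 8722, 8528, 10264,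
      12432, 8800, 11776, 9088, 9288, 8386, 14400, 9474, 13344, 10274, 8360, 12552])
    (X :=
      [27, 58, 75, 89, 113, 114, 135, 156, 163, 166, 204, 267, 275, 277, 284, 294, 330, 356, 389,
      390, 393, 402, 408, 480, 519, 540, 549, 660, 673, 712, 720, 780, 808, 816, 833, 834, 1037,
      1059, 1061, 1068, 1094, 1108, 1162, 1200, 1248, 1328, 1472, 1539, 1560, 1572, 1576, 1665,
      1666, 1796, 1808, 2070, 2089, 2092, 2115, 2132, 2186, 2244, 2256, 2352, 2369, 2376, 2570,
      2577, 2608, 2626, 2632, 2692, 2696, 2817, 3078, 3081, 3152, 3168, 3216, 3360, 3456, 4109,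
      4118, 4137, 4145, 4152, 4166, 4178, 4184, 4194, 4196, 4260, 4289, 4386, 4512, 4544, 4618,
      4673, 4738, 4865, 5130, 5140, 5249, 5377, 5440, 5696, 5760, 6156, 6161, 6177, 6274, 6416,
      6688, 6912, 7170, 7172, 7176])
    (by decide +kernel)) (by decide +kernel) (by decide +kernel) (by decide +kernel)

theorem resolved_cyclic : Resolved cyclic [] := by
  refine resolved_cyclic_rest.of_caught ?_
  have h := caught_nil cyclic
  have h := h.orbit_append stabilize_cyclic resolved_cyclic_with_113
  have h := h.orbit_append stabilize_cyclic resolved_cyclic_with_4448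
  have h := h.orbit_append stabilize_cyclic resolved_cyclic_with_6672
  exact h

/-- The blocks of a quadruple system through its last point, for the other Steiner triple system. -/
def acyclic : List ℕ :=
  [8323, 8213, 12297, 10273, 8513, 9729, 8230, 8458, 8722, 12354, 11266, 8268, 8836, 9476, 14340,
  8344, 9256, 10760, 8496, 10320, 13328, 8800, 12448, 9408, 10624, 13056]

/-- Relabellings that preserve `acyclic`. -/
def acyclicSymmetries : List ℕ :=
  [0xdcba9876543210, 0xdb852c9630a741, 0xd8c37b26a15904, 0xd41a20763c59b8, 0xd103942658a7cb,
  0xd0457196ab328c]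

theorem stabilize_acyclic : stabilize acyclicSymmetries acyclic = true := by decide +kernel

/-- Representatives of orbits of quadruples under `acyclicSymmetries`; the systems meeting an orbit
are treated in turn, from the last orbit to the first. -/
def acyclicQuadruples : List ℕ := [4448, 4800, 3137, 232, 1604, 360, 1856, 464, 4424]

theorem resolved_acyclic_with_4424 : Resolved (4424 :: acyclic)
    [] :=
  Resolved.relabel (σ := 0xdc38091b67a524) (resolved_of_run (n := 4000)
    (F :=
      [7680, 8214, 8368, 13328, 8280, 10768, 8465, 8292, 9732, 8325, 14340, 8460, 11296, 8227,
      8992, 12328, 9346, 9536, 9225, 8896, 10376, 12672, 10305, 12354, 10498, 8714, 12801])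
    (X :=
      [])
    (by decide +kernel)) (by decide +kernel) (by decide +kernel) (by decide +kernel)

theorem resolved_acyclic_with_464 : Resolved (464 :: acyclic)
    ((acyclicQuadruples.drop 8).flatMap (orbit acyclicSymmetries)) :=
  Resolved.relabel (σ := 0xd6015a9c8b2743) (resolved_of_run (n := 4000)
    (F :=
      [7680, 8728, 10376, 8268, 8457, 13320, 8234, 8592, 9236, 10288, 12368, 8211, 12420, 8864,
      9346, 8385, 10756, 8454, 8229, 11520, 14337, 10306, 12576, 9024, 12802, 9729, 9312])
    (X :=
      [4124, 4163, 5188, 5377, 6162, 6408])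
    (by decide +kernel)) (by decide +kernel) (by decide +kernel) (by decide +kernel)

theorem resolved_acyclic_with_1856 : Resolved (1856 :: acyclic)
    ((acyclicQuadruples.drop 7).flatMap (orbit acyclicSymmetries)) :=
  Resolved.relabel (σ := 0xd309ab4c257681) (resolved_of_run (n := 4000)
    (F :=
      [7680, 8466, 8290, 8330, 8199, 14338, 9730, 8516, 10624, 9504, 12552, 8961, 12480, 9296,
      10816, 8265, 8368, 8836, 9345, 10276, 12321, 8744, 13316, 8220, 12816, 10257, 11272])
    (X :=
      [4122, 4134, 4417, 4482, 4617, 4896, 5130, 5377, 6149, 6192, 6240, 6280])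
    (by decide +kernel)) (by decide +kernel) (by decide +kernel) (by decide +kernel)

theorem resolved_acyclic_with_360 : Resolved (360 :: acyclic)
    ((acyclicQuadruples.drop 6).flatMap (orbit acyclicSymmetries)) :=
  Resolved.relabel (σ := 0xd7134b8c96a502) (resolved_of_run (n := 4000)
    (F :=
      [7680, 8453, 8292, 9348, 8710, 14340, 8220, 8737, 11265, 8273, 12417, 8203, 13344, 8496,
      10280, 8354, 9536, 9736, 9234, 10816, 12354, 8392, 12816, 9088, 12552, 10498, 10384])
    (X :=
      [4115, 4131, 4140, 4169, 4234, 4244, 4484, 4676, 4768, 4865, 5125, 5200, 5378, 6168, 6240,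
      6464, 6658, 7296])
    (by decide +kernel)) (by decide +kernel) (by decide +kernel) (by decide +kernel)

theorem resolved_acyclic_with_1604 : Resolved (1604 :: acyclic)
    ((acyclicQuadruples.drop 5).flatMap (orbit acyclicSymmetries)) :=
  Resolved.relabel (σ := 0xd21c960b573a48) (resolved_of_run (n := 4000)
    (F :=
      [7680, 8465, 9600, 8460, 8482, 10560, 13056, 9264, 8280, 8848, 10260, 12306, 11272, 9729,
      13376, 9222, 8329, 12328, 8714, 8416, 10370, 12420, 10784, 8229, 14337, 8259, 8772])
    (X :=
      [2059, 2097, 2124, 2146, 2152, 2241, 2309, 2328, 2344, 2464, 2578, 2696, 2820, 3090, 3108,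
      3264, 6150, 6156, 6168, 6178, 6288, 6304, 6720, 7424])
    (by decide +kernel)) (by decide +kernel) (by decide +kernel) (by decide +kernel)

theorem resolved_acyclic_with_232 : Resolved (232 :: acyclic)
    ((acyclicQuadruples.drop 4).flatMap (orbit acyclicSymmetries)) :=
  Resolved.relabel (σ := 0xd837169ca4b250) (resolved_of_run (n := 4000)
    (F :=
      [7680, 8737, 8213, 10497, 9225, 12353, 8323, 9252, 10336, 8242, 12576, 8360, 14340, 8710,
      8388, 8460, 10768, 11392, 10250, 9296, 12312, 8592, 13314, 9984, 12928, 8776, 8514])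
    (X :=
      [4138, 4140, 4180, 4229, 4230, 4272, 4290, 4355, 4488, 4688, 4865, 5137, 5192, 5256, 5264,
      5380, 5636, 5664, 6162, 6177, 6304, 6464, 6528, 6658, 6664, 7169, 7232])
    (by decide +kernel)) (by decide +kernel) (by decide +kernel) (by decide +kernel)

theorem resolved_acyclic_with_3137 : Resolved (3137 :: acyclic)
    ((acyclicQuadruples.drop 3).flatMap (orbit acyclicSymmetries)) :=
  Resolved.relabel (σ := 0xd39c126a08754b) (resolved_of_run (n := 4000)
    (F :=
      [7680, 10320, 10528, 10376, 10753, 11268, 14338, 8241, 8340, 8466, 9240, 12816, 9376, 8290,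
      12324, 8744, 8640, 12417, 8834, 8453, 9984, 12552, 9219, 8265, 13376, 8772, 8206])
    (X :=
      [1065, 1105, 1121, 1157, 1164, 1217, 1218, 1316, 1348, 1410, 1541, 1554, 1584, 1728, 3082,
      3144, 3201, 3216, 3329, 5126, 5153, 5154, 5250, 5256, 5264, 5377, 5392, 5633, 5640, 7200])
    (by decide +kernel)) (by decide +kernel) (by decide +kernel) (by decide +kernel)

theorem resolved_acyclic_with_4800 : Resolved (4800 :: acyclic)
    ((acyclicQuadruples.drop 2).flatMap (orbit acyclicSymmetries)) :=
  Resolved.relabel (σ := 0xd937a6cb528410) (resolved_of_run (n := 4000)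
    (F :=
      [7680, 12291, 8213, 8961, 8233, 10305, 9345, 8242, 8514, 9222, 10754, 8330, 10512, 13328,
      8400, 8728, 12548, 8608, 9480, 8292, 10252, 8836, 11296, 12832, 14464, 12360, 9792])
    (X :=
      [2074, 2085, 2132, 2146, 2152, 2182, 2185, 2193, 2212, 2216, 2224, 2242, 2307, 2313, 2337,
      2400, 2434, 2596, 2608, 2696, 2820, 2880, 2944, 3082, 3216, 3264, 3332, 3456, 3585, 6178,
      6192, 6212, 6408, 6432, 6657, 7424])
    (by decide +kernel)) (by decide +kernel) (by decide +kernel) (by decide +kernel)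

theorem resolved_acyclic_with_4448 : Resolved (4448 :: acyclic)
    ((acyclicQuadruples.drop 1).flatMap (orbit acyclicSymmetries)) :=
  Resolved.relabel (σ := 0xdb823c6a907541) (resolved_of_run (n := 4000)
    (F :=
      [7680, 8274, 8227, 10370, 8962, 13314, 8206, 8752, 12432, 8217, 11280, 8468, 9376, 8296,
      12324, 10528, 8385, 8836, 8584, 12801, 9473, 10245, 9736, 10816, 9284, 12608, 14344])
    (X :=
      [1045, 1062, 1068, 1080, 1098, 1121, 1161, 1164, 1170, 1172, 1224, 1286, 1304, 1320, 1328,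
      1410, 1472, 1539, 1541, 1572, 1616, 1632, 1666, 1728, 1796, 3082, 3138, 3144, 3201, 3204,
      3332, 3585, 3616, 5132, 5140, 5153, 5185, 5216, 5648, 5760, 5888, 7296])
    (by decide +kernel)) (by decide +kernel) (by decide +kernel) (by decide +kernel)

theorem resolved_acyclic_rest : Resolved acyclic
    (acyclicQuadruples.flatMap (orbit acyclicSymmetries)) :=
  Resolved.relabel (σ := 0xd93b720c18a654) (resolved_of_run (n := 4000)
    (F :=
      [8241, 8528, 9744, 8218, 12308, 10384, 8290, 9252, 8608, 12832, 10280, 13376, 8385, 10308,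
      8776, 9473, 11266, 9352, 8454, 12552, 11008, 12418, 8707, 14337, 8205, 8836])
    (X :=
      [4110, 4131, 4134, 4163, 4165, 4200, 4241, 4264, 4296, 4320, 4357, 4370, 4386, 4417, 4420,
      4614, 4625, 4674, 4737, 4752, 4866, 5123, 5126, 5129, 5138, 5144, 5168, 5249, 5392, 5504,
      5636, 5640, 5888, 6154, 6156, 6168, 6180, 6192, 6210, 6224, 6276, 6336, 6402, 6432, 6664,
      7200, 7296, 7680])
    (by decide +kernel)) (by decide +kernel) (by decide +kernel) (by decide +kernel)

/-- A system either avoids all nine orbits or meets one; if it meets one, the last such orbit in the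
list supplies, after a symmetry, a system with the representative and without the later orbits. -/
theorem resolved_acyclic : Resolved acyclic [] := by
  refine resolved_acyclic_rest.of_caught ?_
  have h := caught_nil acyclic
  have h := h.orbit_append stabilize_acyclic resolved_acyclic_with_4424
  have h := h.orbit_append stabilize_acyclic resolved_acyclic_with_464
  have h := h.orbit_append stabilize_acyclic resolved_acyclic_with_1856
  have h := h.orbit_append stabilize_acyclic resolved_acyclic_with_360
  have h := h.orbit_append stabilize_acyclic resolved_acyclic_with_1604
  have h := h.orbit_append stabilize_acyclic resolved_acyclic_with_232
  have h := h.orbit_append stabilize_acyclic resolved_acyclic_with_3137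
  have h := h.orbit_append stabilize_acyclic resolved_acyclic_with_4800
  have h := h.orbit_append stabilize_acyclic resolved_acyclic_with_4448
  exact h

/-! ### Steiner triple systems on thirteen points, up to isomorphism -/

/-- Branchings that lead from the empty list of blocks to `cyclic` and `acyclic`. -/
def branchings : List Node := [
  ⟨[8199, 8217, 8234, 8244, 8289, 8577, 9729, 14337, 8864, 10528, 13344, 8338, 12354, 12560, 8962,
    11266, 9296, 10768, 9476, 8520, 9352, 10252, 12808, 8772, 12420], 8384, [⟨11,
    0xd52ba4970836c1, 0⟩]⟩,
  ⟨[8199, 8217, 8234, 8244, 8289, 8577, 9729, 14337, 8864, 10528, 13344, 8338, 12354, 12560, 8962,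
    11266, 9296, 10768, 9476, 8520, 9352, 10252, 12808, 8772], 12292, [⟨7, 0xdcba9876543210, 0⟩]⟩,
  ⟨[8199, 8217, 8234, 8244, 8289, 8577, 9729, 14337, 8864, 10528, 13344, 8338, 12354, 12560, 8962,
    11266, 9296, 10768, 9476, 8520, 9352, 10252, 12808], 8708, [⟨6, 0xdcba9876543210, 0⟩]⟩,
  ⟨[8199, 8217, 8234, 8244, 8289, 8577, 9729, 14337, 8864, 10528, 13344, 8338, 12354, 12560, 8962,
    11266, 9296, 10768, 9476, 8520, 9352, 10252], 8712, [⟨12, 0xdcba9876543210, 0⟩]⟩,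
  ⟨[8199, 8217, 8234, 8244, 8289, 8577, 9729, 14337, 8864, 10528, 13344, 8338, 12354, 12560, 8962,
    11266, 9296, 10768, 9476, 8520, 9352], 10248, [⟨2, 0xdcba9876543210, 0⟩]⟩,
  ⟨[8199, 8217, 8234, 8244, 8289, 8577, 9729, 14337, 8864, 10528, 13344, 8338, 12354, 12560, 8962,
    11266, 9296, 10768, 9476, 8520], 9224, [⟨7, 0xdcba9876543210, 0⟩]⟩,
  ⟨[8199, 8217, 8234, 8244, 8289, 8577, 9729, 14337, 8864, 10528, 13344, 8338, 12354, 12560, 8962,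
    11266, 9296, 10768, 9476], 8512, [⟨3, 0xdcba9876543210, 0⟩]⟩,
  ⟨[8199, 8217, 8234, 8244, 8289, 8577, 9729, 14337, 8864, 10528, 13344, 8338, 12354, 12560, 8962,
    11266, 9296, 10768, 9480, 8516, 9348, 10252], 10304, [⟨7, 0xd625718a0c3b49, 0⟩]⟩,
  ⟨[8199, 8217, 8234, 8244, 8289, 8577, 9729, 14337, 8864, 10528, 13344, 8338, 12354, 12560, 8962,
    11266, 9296, 10768, 9480, 8516, 9348], 10244, [⟨3, 0xdcba9876543210, 0⟩]⟩,
  ⟨[8199, 8217, 8234, 8244, 8289, 8577, 9729, 14337, 8864, 10528, 13344, 8338, 12354, 12560, 8962,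
    11266, 9296, 10768, 9480, 8516], 9220, [⟨7, 0xdcba9876543210, 0⟩]⟩,
  ⟨[8199, 8217, 8234, 8244, 8289, 8577, 9729, 14337, 8864, 10528, 13344, 8338, 12354, 12560, 8962,
    11266, 9296, 10768, 9480], 8512, [⟨2, 0xdcba9876543210, 0⟩]⟩,
  ⟨[8199, 8217, 8234, 8244, 8289, 8577, 9729, 14337, 8864, 10528, 13344, 8338, 12354, 12560, 8962,
    11266, 9296, 10768], 9472, [⟨2, 0xdcba9876543210, 4⟩, ⟨3, 0xdcba9876543210, 0⟩]⟩,
  ⟨[8199, 8217, 8234, 8244, 8289, 8577, 9729, 14337, 8864, 10528, 13344, 8338, 12354, 12560, 8962,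
    11266, 9296], 8720, [⟨11, 0xdcba9876543210, 0⟩]⟩,
  ⟨[8199, 8217, 8234, 8244, 8289, 8577, 9729, 14337, 8864, 10528, 13344, 8338, 12354, 12560, 8962,
    11266], 9232, [⟨6, 0xdcba9876543210, 0⟩]⟩,
  ⟨[8199, 8217, 8234, 8244, 8289, 8577, 9729, 14337, 8864, 10528, 13344, 8338, 12354, 12560,
    8962], 9218, [⟨11, 0xdcba9876543210, 0⟩]⟩,
  ⟨[8199, 8217, 8234, 8244, 8289, 8577, 9729, 14337, 8864, 10528, 13344, 8338, 12354, 12560, 9474,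
    10754, 8784, 11280, 8964, 12808, 12420, 8520, 10252], 8328, [⟨10, 0xd29a41c38057b6, 9⟩]⟩,
  ⟨[8199, 8217, 8234, 8244, 8289, 8577, 9729, 14337, 8864, 10528, 13344, 8338, 12354, 12560, 9474,
    10754, 8784, 11280, 8964, 12808, 12420, 8520], 8204, [⟨10, 0xd9a78cb6521430, 1⟩, ⟨11,
    0xdcba9876543210, 0⟩]⟩,
  ⟨[8199, 8217, 8234, 8244, 8289, 8577, 9729, 14337, 8864, 10528, 13344, 8338, 12354, 12560, 9474,
    10754, 8784, 11280, 8964, 12808, 12420], 8456, [⟨6, 0xdcba9876543210, 0⟩]⟩,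
  ⟨[8199, 8217, 8234, 8244, 8289, 8577, 9729, 14337, 8864, 10528, 13344, 8338, 12354, 12560, 9474,
    10754, 8784, 11280, 8964, 12808], 12292, [⟨7, 0xdcba9876543210, 0⟩]⟩,
  ⟨[8199, 8217, 8234, 8244, 8289, 8577, 9729, 14337, 8864, 10528, 13344, 8338, 12354, 12560, 9474,
    10754, 8784, 11280, 8964], 12800, [⟨3, 0xdcba9876543210, 0⟩]⟩,
  ⟨[8199, 8217, 8234, 8244, 8289, 8577, 9729, 14337, 8864, 10528, 13344, 8338, 12354, 12560, 9474,
    10754, 8784, 11280, 8968, 12804, 8516, 12424, 10252, 9348, 9288], 8384, [⟨11,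
    0xd6ab8c53419027, 21⟩]⟩,
  ⟨[8199, 8217, 8234, 8244, 8289, 8577, 9729, 14337, 8864, 10528, 13344, 8338, 12354, 12560, 9474,
    10754, 8784, 11280, 8968, 12804, 8516, 12424, 10252, 9348], 9224, [⟨6, 0xdcba9876543210, 0⟩]⟩,
  ⟨[8199, 8217, 8234, 8244, 8289, 8577, 9729, 14337, 8864, 10528, 13344, 8338, 12354, 12560, 9474,
    10754, 8784, 11280, 8968, 12804, 8516, 12424, 10252], 8324, [⟨10, 0xdcba9876543210, 0⟩]⟩,
  ⟨[8199, 8217, 8234, 8244, 8289, 8577, 9729, 14337, 8864, 10528, 13344, 8338, 12354, 12560, 9474,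
    10754, 8784, 11280, 8968, 12804, 8516, 12424], 8204, [⟨10, 0xd9a78cb6534120, 8⟩, ⟨11,
    0xdcba9876543210, 0⟩]⟩,
  ⟨[8199, 8217, 8234, 8244, 8289, 8577, 9729, 14337, 8864, 10528, 13344, 8338, 12354, 12560, 9474,
    10754, 8784, 11280, 8968, 12804, 8516], 12296, [⟨7, 0xdcba9876543210, 0⟩]⟩,
  ⟨[8199, 8217, 8234, 8244, 8289, 8577, 9729, 14337, 8864, 10528, 13344, 8338, 12354, 12560, 9474,
    10754, 8784, 11280, 8968, 12804], 8452, [⟨6, 0xdcba9876543210, 0⟩]⟩,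
  ⟨[8199, 8217, 8234, 8244, 8289, 8577, 9729, 14337, 8864, 10528, 13344, 8338, 12354, 12560, 9474,
    10754, 8784, 11280, 8968], 12800, [⟨2, 0xdcba9876543210, 0⟩]⟩,
  ⟨[8199, 8217, 8234, 8244, 8289, 8577, 9729, 14337, 8864, 10528, 13344, 8338, 12354, 12560, 9474,
    10754, 8784, 11280], 8960, [⟨2, 0xdcba9876543210, 7⟩, ⟨3, 0xdcba9876543210, 0⟩]⟩,
  ⟨[8199, 8217, 8234, 8244, 8289, 8577, 9729, 14337, 8864, 10528, 13344, 8338, 12354, 12560, 9474,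
    10754, 8784], 9232, [⟨11, 0xdcba9876543210, 0⟩]⟩,
  ⟨[8199, 8217, 8234, 8244, 8289, 8577, 9729, 14337, 8864, 10528, 13344, 8338, 12354, 12560, 9474,
    10754], 8720, [⟨6, 0xdcba9876543210, 0⟩]⟩,
  ⟨[8199, 8217, 8234, 8244, 8289, 8577, 9729, 14337, 8864, 10528, 13344, 8338, 12354, 12560,
    9474], 8706, [⟨11, 0xdcba9876543210, 0⟩]⟩,
  ⟨[8199, 8217, 8234, 8244, 8289, 8577, 9729, 14337, 8864, 10528, 13344, 8338, 12354, 12560],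
    8450, [⟨9, 0xdcba9876543210, 16⟩, ⟨10, 0xdcba9876543210, 0⟩]⟩,
  ⟨[8199, 8217, 8234, 8244, 8289, 8577, 9729, 14337, 8864, 10528, 13344, 8338, 12354], 12304, [⟨8,
    0xdcba9876543210, 0⟩, ⟨9, 0xdcab8976042315, 0⟩]⟩,
  ⟨[8199, 8217, 8234, 8244, 8289, 8577, 9729, 14337, 8864, 10528, 13344, 8338, 12546, 12816, 8770,
    11266, 10320], 8464, [⟨10, 0xda8b9c67402351, 5⟩]⟩,
  ⟨[8199, 8217, 8234, 8244, 8289, 8577, 9729, 14337, 8864, 10528, 13344, 8338, 12546, 12816, 8770,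
    11266], 10256, [⟨6, 0xdcba9876543210, 0⟩]⟩,
  ⟨[8199, 8217, 8234, 8244, 8289, 8577, 9729, 14337, 8864, 10528, 13344, 8338, 12546, 12816,
    8770], 9218, [⟨11, 0xdcba9876543210, 0⟩]⟩,
  ⟨[8199, 8217, 8234, 8244, 8289, 8577, 9729, 14337, 8864, 10528, 13344, 8338, 12546, 12816,
    10754, 9282, 9488, 10320, 8964, 8520], 8768, []⟩,
  ⟨[8199, 8217, 8234, 8244, 8289, 8577, 9729, 14337, 8864, 10528, 13344, 8338, 12546, 12816,
    10754, 9282, 9488, 10320, 8964], 8512, [⟨3, 0xdcba9876543210, 0⟩]⟩,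
  ⟨[8199, 8217, 8234, 8244, 8289, 8577, 9729, 14337, 8864, 10528, 13344, 8338, 12546, 12816,
    10754, 9282, 9488, 10320, 8968], 8512, [⟨2, 0xdc36b5941082a7, 5⟩]⟩,
  ⟨[8199, 8217, 8234, 8244, 8289, 8577, 9729, 14337, 8864, 10528, 13344, 8338, 12546, 12816,
    10754, 9282, 9488, 10320, 9024, 8460], 8708, []⟩,
  ⟨[8199, 8217, 8234, 8244, 8289, 8577, 9729, 14337, 8864, 10528, 13344, 8338, 12546, 12816,
    10754, 9282, 9488, 10320, 9024], 8452, [⟨3, 0xdcba9876543210, 0⟩]⟩,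
  ⟨[8199, 8217, 8234, 8244, 8289, 8577, 9729, 14337, 8864, 10528, 13344, 8338, 12546, 12816,
    10754, 9282, 9488, 10320], 8960, [⟨2, 0xdcba9876543210, 3⟩, ⟨3, 0xdcba9876543210, 2⟩, ⟨6,
    0xdcba9876543210, 0⟩]⟩,
  ⟨[8199, 8217, 8234, 8244, 8289, 8577, 9729, 14337, 8864, 10528, 13344, 8338, 12546, 12816,
    10754, 9282, 9488], 10256, [⟨6, 0xdcba9876543210, 0⟩]⟩,
  ⟨[8199, 8217, 8234, 8244, 8289, 8577, 9729, 14337, 8864, 10528, 13344, 8338, 12546, 12816,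
    10754, 9282], 8464, [⟨6, 0xdcab8976013245, 7⟩, ⟨10, 0xdcba9876543210, 0⟩]⟩,
  ⟨[8199, 8217, 8234, 8244, 8289, 8577, 9729, 14337, 8864, 10528, 13344, 8338, 12546, 12816,
    10754], 9218, [⟨6, 0xdcba9876543210, 0⟩]⟩,
  ⟨[8199, 8217, 8234, 8244, 8289, 8577, 9729, 14337, 8864, 10528, 13344, 8338, 12546, 12816],
    8706, [⟨6, 0xdcba9876543210, 9⟩, ⟨11, 0xdcba9876543210, 0⟩]⟩,
  ⟨[8199, 8217, 8234, 8244, 8289, 8577, 9729, 14337, 8864, 10528, 13344, 8338, 12546], 12304, [⟨6,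
    0xdcba9876512340, 14⟩, ⟨9, 0xdcba9876543210, 0⟩]⟩,
  ⟨[8199, 8217, 8234, 8244, 8289, 8577, 9729, 14337, 8864, 10528, 13344, 8338], 12290, [⟨6,
    0xdcba9876543210, 14⟩, ⟨8, 0xdcba9876543210, 0⟩, ⟨9, 0xdcab8976042315, 0⟩]⟩,
  ⟨[8199, 8217, 8234, 8244, 8289, 8577, 9729, 14337, 8864, 10528, 13344, 8386], 8210, [⟨8,
    0xda9cb786543210, 0⟩, ⟨9, 0xdbc87a96543210, 0⟩, ⟨10, 0xd9a78cb6543210, 0⟩, ⟨11,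
    0xd87bc9a6543210, 0⟩, ⟨12, 0xd789abc6543210, 15⟩]⟩,
  ⟨[8199, 8217, 8234, 8244, 8289, 8577, 9729, 14337, 8864, 10528, 13344, 9346, 10754, 8274, 12546,
    10384, 9488, 12816, 12420], 8328, [⟨6, 0xd476920ba8c351, 2⟩]⟩,
  ⟨[8199, 8217, 8234, 8244, 8289, 8577, 9729, 14337, 8864, 10528, 13344, 9346, 10754, 8274, 12546,
    10384, 9488, 12816], 8324, [⟨3, 0xdcba9876534120, 2⟩, ⟨6, 0xda9bc874356120, 2⟩, ⟨12,
    0xdcba9876543210, 0⟩]⟩,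
  ⟨[8199, 8217, 8234, 8244, 8289, 8577, 9729, 14337, 8864, 10528, 13344, 9346, 10754, 8274, 12546,
    10384, 9488], 8720, [⟨12, 0xdcba9876543210, 0⟩]⟩,
  ⟨[8199, 8217, 8234, 8244, 8289, 8577, 9729, 14337, 8864, 10528, 13344, 9346, 10754, 8274, 12546,
    10384], 9232, [⟨8, 0xdcba9876543210, 0⟩]⟩,
  ⟨[8199, 8217, 8234, 8244, 8289, 8577, 9729, 14337, 8864, 10528, 13344, 9346, 10754, 8274,
    12546], 8336, [⟨11, 0xdcba9876543210, 0⟩, ⟨12, 0xdbc9a872143650, 0⟩]⟩,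
  ⟨[8199, 8217, 8234, 8244, 8289, 8577, 9729, 14337, 8864, 10528, 13344, 9346, 10754, 8274], 8450,
    [⟨12, 0xdcba9876543210, 0⟩]⟩,
  ⟨[8199, 8217, 8234, 8244, 8289, 8577, 9729, 14337, 8864, 10528, 13344, 9346, 10754], 8210, [⟨6,
    0xdcba9876543210, 0⟩, ⟨8, 0xda9cb786543210, 8⟩, ⟨12, 0xd798bac6042315, 8⟩]⟩,
  ⟨[8199, 8217, 8234, 8244, 8289, 8577, 9729, 14337, 8864, 10528, 13344, 9346], 10242, [⟨4,
    0xd87bc9a6543210, 8⟩, ⟨6, 0xd87bc9a6543210, 7⟩, ⟨9, 0xdcba9876543210, 0⟩]⟩,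
  ⟨[8199, 8217, 8234, 8244, 8289, 8577, 9729, 14337, 8864, 10528, 13344, 12418], 8336, [⟨6,
    0xdcba9876512340, 8⟩, ⟨10, 0xdcba9876512340, 0⟩, ⟨11, 0xd87bc9a6512340, 0⟩]⟩,
  ⟨[8199, 8217, 8234, 8244, 8289, 8577, 9729, 14337, 8864, 10528, 13344], 8322, [⟨4,
    0xdcba9876543210, 10⟩, ⟨6, 0xdcba9876543210, 9⟩, ⟨10, 0xdcba9876543210, 1⟩, ⟨11,
    0xd87bc9a6543210, 1⟩, ⟨12, 0xdcba9876543210, 0⟩]⟩,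
  ⟨[8199, 8217, 8234, 8244, 8289, 8577, 9729, 14337, 8864, 10528], 9248, [⟨12, 0xdcba9876543210,
    0⟩]⟩,
  ⟨[8199, 8217, 8234, 8244, 8289, 8577, 9729, 14337, 8864], 10272, [⟨8, 0xdcba9876543210, 0⟩, ⟨10,
    0xdcb87a96543210, 0⟩]⟩,
  ⟨[8199, 8217, 8234, 8244, 8289, 8577, 9729, 14337], 8352, [⟨9, 0xdcba9876543210, 0⟩, ⟨10,
    0xdcb9a876543210, 0⟩, ⟨11, 0xda9cb876543210, 0⟩, ⟨12, 0xd9acb876543210, 0⟩]⟩,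
  ⟨[8199, 8217, 8234, 8244, 8289, 8577, 9729], 10241, [⟨12, 0xdcba9876543210, 0⟩]⟩,
  ⟨[8199, 8217, 8234, 8244, 8289, 8577], 8705, [⟨10, 0xdcba9876543210, 0⟩, ⟨11, 0xdcab9876543210,
    0⟩, ⟨12, 0xdacb9876543210, 0⟩]⟩,
  ⟨[8199, 8217, 8234, 8244, 8289], 8321, [⟨8, 0xdcba9876543210, 0⟩, ⟨9, 0xdcba8976543210, 0⟩, ⟨10,
    0xdcb8a976543210, 0⟩, ⟨11, 0xdc8ba976543210, 0⟩, ⟨12, 0xd8cba976543210, 0⟩]⟩,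
  ⟨[8199, 8217, 8234, 8244], 8225, [⟨6, 0xdcba9876543210, 0⟩, ⟨7, 0xdcba9867543210, 0⟩, ⟨8,
    0xdcba9687543210, 0⟩, ⟨9, 0xdcba6987543210, 0⟩, ⟨10, 0xdcb6a987543210, 0⟩, ⟨11,
    0xdc6ba987543210, 0⟩, ⟨12, 0xd6cba987543210, 0⟩]⟩,
  ⟨[8199, 8217, 8289, 8577, 9729, 14337, 8234, 8338, 8770, 10498, 13314, 12300, 8520, 8840, 11272,
    12368], 9280, [⟨2, 0xdbc439a5687210, 6⟩, ⟨7, 0xd3a46925817c0b, 6⟩]⟩,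
  ⟨[8199, 8217, 8289, 8577, 9729, 14337, 8234, 8338, 8770, 10498, 13314, 12300, 8520, 8840, 11272,
    12480], 9280, [⟨2, 0xd9a438756cb210, 7⟩, ⟨4, 0xd4a36925817c0b, 7⟩]⟩,
  ⟨[8199, 8217, 8289, 8577, 9729, 14337, 8234, 8338, 8770, 10498, 13314, 12300, 8520, 8840,
    11272], 12352, [⟨4, 0xdcba9876543210, 1⟩, ⟨7, 0xdcba9876543210, 0⟩]⟩,
  ⟨[8199, 8217, 8289, 8577, 9729, 14337, 8234, 8338, 8770, 10498, 13314, 12300, 8520, 8840], 9224,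
    [⟨11, 0xdcba9876543210, 0⟩]⟩,
  ⟨[8199, 8217, 8289, 8577, 9729, 14337, 8234, 8338, 8770, 10498, 13314, 12300, 8520], 8712, [⟨7,
    0xdcba9876543210, 0⟩, ⟨11, 0xdb4c23a1695807, 10⟩]⟩,
  ⟨[8199, 8217, 8289, 8577, 9729, 14337, 8234, 8338, 8770, 10498, 13314, 12300, 8968, 8392, 11272,
    10308], 9344, [⟨2, 0xd634cb21a80597, 10⟩, ⟨5, 0xdabc7834250916, 0⟩]⟩,
  ⟨[8199, 8217, 8289, 8577, 9729, 14337, 8234, 8338, 8770, 10498, 13314, 12300, 8968, 8392,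
    11272], 10304, [⟨2, 0xdcba9876543210, 0⟩, ⟨4, 0xdacb8743520961, 1⟩]⟩,
  ⟨[8199, 8217, 8289, 8577, 9729, 14337, 8234, 8338, 8770, 10498, 13314, 12300, 8968, 8392], 9224,
    [⟨11, 0xdcba9876543210, 0⟩]⟩,
  ⟨[8199, 8217, 8289, 8577, 9729, 14337, 8234, 8338, 8770, 10498, 13314, 12300, 8968, 9288, 10376,
    10308], 8384, [⟨12, 0xd2369a458c017b, 14⟩]⟩,
  ⟨[8199, 8217, 8289, 8577, 9729, 14337, 8234, 8338, 8770, 10498, 13314, 12300, 8968, 9288,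
    10376], 10304, [⟨2, 0xdcba9876543210, 0⟩, ⟨4, 0xd43a965cb21780, 4⟩]⟩,
  ⟨[8199, 8217, 8289, 8577, 9729, 14337, 8234, 8338, 8770, 10498, 13314, 12300, 8968, 9288], 8328,
    [⟨11, 0xdcba9876543210, 0⟩]⟩,
  ⟨[8199, 8217, 8289, 8577, 9729, 14337, 8234, 8338, 8770, 10498, 13314, 12300, 8968], 8264, [⟨7,
    0xdcba9876543210, 3⟩, ⟨10, 0xdcba9876543210, 0⟩, ⟨11, 0xdb3c24a1695807, 17⟩]⟩,
  ⟨[8199, 8217, 8289, 8577, 9729, 14337, 8234, 8338, 8770, 10498, 13314, 12300, 9480, 10760,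
    8392], 8512, [⟨2, 0xd659a34cb78210, 0⟩, ⟨4, 0xdcba9435621870, 17⟩, ⟨12, 0xd3547698bac201, 7⟩]⟩,
  ⟨[8199, 8217, 8289, 8577, 9729, 14337, 8234, 8338, 8770, 10498, 13314, 12300, 9480, 10760],
    8264, [⟨7, 0xdcba9876543210, 0⟩]⟩,
  ⟨[8199, 8217, 8289, 8577, 9729, 14337, 8234, 8338, 8770, 10498, 13314, 12300, 9480], 8712, [⟨7,
    0xdbc4321a965870, 20⟩, ⟨11, 0xdcba9876543210, 0⟩]⟩,
  ⟨[8199, 8217, 8289, 8577, 9729, 14337, 8234, 8338, 8770, 10498, 13314, 12300], 8456, [⟨6,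
    0xdcba9876543210, 10⟩, ⟨9, 0xdcba9876543210, 3⟩, ⟨10, 0xdcba9876543210, 0⟩]⟩,
  ⟨[8199, 8217, 8289, 8577, 9729, 14337, 8234, 8338, 8770, 10498, 13314, 12360, 8528, 12308,
    8752], 9232, [⟨11, 0xdca96473502b81, 11⟩]⟩,
  ⟨[8199, 8217, 8289, 8577, 9729, 14337, 8234, 8338, 8770, 10498, 13314, 12360, 8528, 12308],
    8720, [⟨5, 0xdcba9876543210, 0⟩, ⟨11, 0xdb4c2361a59807, 23⟩]⟩,
  ⟨[8199, 8217, 8289, 8577, 9729, 14337, 8234, 8338, 8770, 10498, 13314, 12360, 8528, 12816,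
    12576, 12420], 8352, [⟨9, 0xd1a24983675b0c, 0⟩, ⟨10, 0xd07294c63a5b18, 13⟩, ⟨11,
    0xd43cb2165a9870, 23⟩]⟩,
  ⟨[8199, 8217, 8289, 8577, 9729, 14337, 8234, 8338, 8770, 10498, 13314, 12360, 8528, 12816,
    12576], 12416, [⟨2, 0xdcba9876543210, 0⟩]⟩,
  ⟨[8199, 8217, 8289, 8577, 9729, 14337, 8234, 8338, 8770, 10498, 13314, 12360, 8528, 12816],
    12544, [⟨2, 0xd53684c7ab9201, 26⟩, ⟨5, 0xdcba9876543210, 0⟩]⟩,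
  ⟨[8199, 8217, 8289, 8577, 9729, 14337, 8234, 8338, 8770, 10498, 13314, 12360, 8528], 12304, [⟨2,
    0xdcba9876543210, 3⟩, ⟨5, 0xd569acb3421870, 26⟩, ⟨9, 0xdcba9876543210, 0⟩]⟩,
  ⟨[8199, 8217, 8289, 8577, 9729, 14337, 8234, 8338, 8770, 10498, 13314, 12360, 9536, 8276,
    10432], 8328, [⟨2, 0xda9cb657834210, 27⟩, ⟨9, 0xda592631b4c708, 17⟩, ⟨10, 0xd7542360b98a1c,
    4⟩]⟩,
  ⟨[8199, 8217, 8289, 8577, 9729, 14337, 8234, 8338, 8770, 10498, 13314, 12360, 9536, 8276], 8384,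
    [⟨11, 0xdcba9876543210, 0⟩]⟩,
  ⟨[8199, 8217, 8289, 8577, 9729, 14337, 8234, 8338, 8770, 10498, 13314, 12360, 9536], 8272, [⟨2,
    0xdcba9876543210, 0⟩, ⟨11, 0xd3487bc5621a90, 30⟩]⟩,
  ⟨[8199, 8217, 8289, 8577, 9729, 14337, 8234, 8338, 8770, 10498, 13314, 12360], 8512, [⟨2,
    0xd8b74ca3596201, 20⟩, ⟨4, 0xdcba9876543210, 3⟩, ⟨10, 0xdcba9876543210, 0⟩]⟩,
  ⟨[8199, 8217, 8289, 8577, 9729, 14337, 8234, 8338, 8770, 10498, 13314], 12296, [⟨2,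
    0xdcba9876543210, 10⟩, ⟨6, 0xdcba9876543210, 0⟩, ⟨7, 0xdcab8967453201, 0⟩, ⟨8,
    0xd3547698bac201, 0⟩, ⟨9, 0xd3456789abc210, 0⟩]⟩,
  ⟨[8199, 8217, 8289, 8577, 9729, 14337, 8234, 8338, 8770, 10498], 9218, [⟨12, 0xdcba9876543210,
    0⟩]⟩,
  ⟨[8199, 8217, 8289, 8577, 9729, 14337, 8234, 8338, 8770], 10242, [⟨8, 0xdcba9876543210, 0⟩, ⟨10,
    0xdcb87a94365210, 0⟩]⟩,
  ⟨[8199, 8217, 8289, 8577, 9729, 14337, 8234, 8338, 10754], 9218, [⟨6, 0xdcb78a94365210, 1⟩, ⟨8,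
    0xdcb7843a956210, 1⟩, ⟨12, 0xd4321cba987650, 35⟩]⟩,
  ⟨[8199, 8217, 8289, 8577, 9729, 14337, 8234, 8338], 8706, [⟨6, 0xdcba9876543210, 1⟩, ⟨8,
    0xdcba9658734210, 1⟩, ⟨11, 0xdcba9876543210, 0⟩, ⟨12, 0xdbca9876543210, 0⟩]⟩,
  ⟨[8199, 8217, 8289, 8577, 9729, 14337, 8234, 8834], 10242, [⟨4, 0xd87cba96543210, 1⟩, ⟨6,
    0xd87cba94365210, 1⟩, ⟨8, 0xd876543cba9210, 1⟩, ⟨10, 0xd874365cba9210, 1⟩]⟩,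
  ⟨[8199, 8217, 8289, 8577, 9729, 14337, 8234], 8322, [⟨4, 0xdcba9876543210, 1⟩, ⟨6,
    0xdcba9874365210, 1⟩, ⟨9, 0xdcba9876543210, 0⟩, ⟨10, 0xdcb9a876543210, 0⟩, ⟨11,
    0xda9cb876543210, 0⟩, ⟨12, 0xd9acb876543210, 0⟩]⟩,
  ⟨[8199, 8217, 8289, 8577, 9729, 14337], 8202, [⟨5, 0xdcba9876543210, 0⟩, ⟨6, 0xdcba9875643210,
    0⟩, ⟨7, 0xdcba9658743210, 0⟩, ⟨8, 0xdcba9568743210, 0⟩, ⟨9, 0xdcb65a98743210, 0⟩, ⟨10,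
    0xdcb56a98743210, 0⟩, ⟨11, 0xd65cba98743210, 0⟩, ⟨12, 0xd56cba98743210, 0⟩]⟩,
  ⟨[8199, 8217, 8289, 8577, 9729], 10241, [⟨12, 0xdcba9876543210, 0⟩]⟩,
  ⟨[8199, 8217, 8289, 8577], 8705, [⟨10, 0xdcba9876543210, 0⟩, ⟨11, 0xdcab9876543210, 0⟩, ⟨12,
    0xdacb9876543210, 0⟩]⟩,
  ⟨[8199, 8217, 8289], 8321, [⟨8, 0xdcba9876543210, 0⟩, ⟨9, 0xdcba8976543210, 0⟩, ⟨10,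
    0xdcb8a976543210, 0⟩, ⟨11, 0xdc8ba976543210, 0⟩, ⟨12, 0xd8cba976543210, 0⟩]⟩,
  ⟨[8199, 8217], 8225, [⟨6, 0xdcba9876543210, 0⟩, ⟨7, 0xdcba9867543210, 0⟩, ⟨8, 0xdcba9687543210,
    0⟩, ⟨9, 0xdcba6987543210, 0⟩, ⟨10, 0xdcb6a987543210, 0⟩, ⟨11, 0xdc6ba987543210, 0⟩, ⟨12,
    0xd6cba987543210, 0⟩]⟩,
  ⟨[8199], 8201, [⟨4, 0xdcba9876543210, 0⟩, ⟨5, 0xdcba9876453210, 0⟩, ⟨6, 0xdcba9874653210, 0⟩,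
    ⟨7, 0xdcba9847653210, 0⟩, ⟨8, 0xdcba9487653210, 0⟩, ⟨9, 0xdcba4987653210, 0⟩, ⟨10,
    0xdcb4a987653210, 0⟩, ⟨11, 0xdc4ba987653210, 0⟩, ⟨12, 0xd4cba987653210, 0⟩]⟩,
  ⟨[], 8195, [⟨2, 0xdcba9876543210, 0⟩, ⟨3, 0xdcba9876542310, 0⟩, ⟨4, 0xdcba9876524310, 0⟩, ⟨5,
    0xdcba9876254310, 0⟩, ⟨6, 0xdcba9872654310, 0⟩, ⟨7, 0xdcba9827654310, 0⟩, ⟨8,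
    0xdcba9287654310, 0⟩, ⟨9, 0xdcba2987654310, 0⟩, ⟨10, 0xdcb2a987654310, 0⟩, ⟨11,
    0xdc2ba987654310, 0⟩, ⟨12, 0xd2cba987654310, 0⟩]⟩]

theorem checkTree_branchings : checkTree branchings [acyclic, cyclic] = true := by decide +kernel

theorem resolved_nil : Resolved [] [] :=
  checkTree_sound (R := [acyclic, cyclic])
    (by simpa using ⟨resolved_acyclic, resolved_cyclic⟩) checkTree_branchings

theorem IsSystem.hasDominatingPair {𝓑 : Finset (Finset (Fin 14))} (h𝓑 : IsSystem 𝓑) :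
    HasDominatingPair 𝓑 :=
  resolved_nil 𝓑 h𝓑 (by simp) (by simp)

end QuadrupleSearch

/-! ### Steiner quadruple systems of order fourteen -/

namespace QuadrupleSearch

theorem IsSystem.of_isSteinerQuadrupleSystem {𝓑 : Finset (Finset (Fin 14))}
    (h : IsSteinerQuadrupleSystem 14 𝓑) : IsSystem 𝓑 where
  card_block := h.card_block
  exists_block T hT := by
    have h1 := h.card_blocks_through T hT
    obtain ⟨B, hB⟩ := Finset.card_eq_one.1 h1
    have : B ∈ 𝓑.filter fun B => T ⊆ B := hB ▸ Finset.mem_singleton_self B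
    exact ⟨B, Finset.mem_filter.1 this⟩
  eq_block T hT B hB C hC hTB hTC :=
    Finset.card_le_one.1 (h.card_blocks_through T hT).le B (Finset.mem_filter.2 ⟨hB, hTB⟩) C
      (Finset.mem_filter.2 ⟨hC, hTC⟩)

end QuadrupleSearch

section OrderFourteen

open QuadrupleSearch

variable {V : Type*} [Fintype V] [DecidableEq V] {𝓑 : Finset (Finset V)}

theorem IsSimpleDesign.transport {W : Type*} [Fintype W] [DecidableEq W] {t v k lam : ℕ}
    (h : IsSimpleDesign t v k lam 𝓑) (e : V ≃ W) : IsSimpleDesign t v k lam (transport e 𝓑) where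
  card_points := by rw [← h.card_points, Fintype.card_congr e]
  card_block B hB := by
    rw [← Finset.card_map e.symm.toEmbedding]
    exact h.card_block _ (mem_transport.1 hB)
  card_blocks_through T hT := by
    rw [← h.card_blocks_through (T.map e.symm.toEmbedding) (by rw [Finset.card_map, hT]),
      ← Finset.card_map e.symm.finsetCongr.toEmbedding]
    congr 1
    ext B
    rw [Finset.mem_map_equiv, Finset.mem_filter, Finset.mem_filter]
    change B.map e.toEmbedding ∈ _ ∧ T ⊆ B.map e.toEmbedding ↔ _
    rw [map_mem_transport, ← Finset.map_subset_map (f := e.symm.toEmbedding) (s₁ := T),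
      Finset.map_map]
    simp

theorem IsSteinerQuadrupleSystem.hasDominatingPair (h : IsSteinerQuadrupleSystem 14 𝓑) :
    HasDominatingPair 𝓑 :=
  .of_transport (Fintype.equivFinOfCardEq h.card_points)
    (IsSystem.of_isSteinerQuadrupleSystem (IsSimpleDesign.transport h _)).hasDominatingPair

theorem IsSteinerQuadrupleSystem.not_isExistentiallyClosed_two_of_fourteen
    (h : IsSteinerQuadrupleSystem 14 𝓑) :
    ¬ IsExistentiallyClosed (blockIntersectionGraph 𝓑) 2 := by
  obtain ⟨B, hB, C, hC, hBC, hD⟩ := h.hasDominatingPair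
  refine not_isExistentiallyClosed_two hB hC ?_ hD
  rintro rfl
  rw [disjoint_self, Finset.bot_eq_empty] at hBC
  have := h.card_block _ hB
  rw [hBC] at this
  exact absurd this (by simp)

/-- Each admissible order below 16 is excluded separately: order 4 violates 1-closure, orders 8, 10
and 14 violate 2-closure, and below 3 the graph has no vertices. -/
theorem IsSteinerQuadrupleSystem.le_of_existentialClosureNumber_eq_two {v : ℕ}
    (h : IsSteinerQuadrupleSystem v 𝓑)
    (h2 : existentialClosureNumber (blockIntersectionGraph 𝓑) = 2) : 16 ≤ v := by
  by_contra! hv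
  rcases h.order_cases hv with hv | rfl | rfl | rfl | rfl
  · have : IsEmpty {B // B ∈ 𝓑} := ⟨fun B => by
      have h1 := B.1.card_le_univ
      rw [h.card_block _ B.2, h.card_points] at h1
      omega⟩
    exact existentialClosureNumber_ne_two_of_isEmpty _ h2
  · exact h.not_isExistentiallyClosed_one_of_four
      (closed_of_existentialClosureNumber_eq_two h2 le_rfl one_le_two)
  · exact h.not_isExistentiallyClosed_two_of_eight
      (closed_of_existentialClosureNumber_eq_two h2 one_le_two le_rfl)
  · exact h.not_isExistentiallyClosed_two_of_ten
      (closed_of_existentialClosureNumber_eq_two h2 one_le_two le_rfl)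
  · exact h.not_isExistentiallyClosed_two_of_fourteen
      (closed_of_existentialClosureNumber_eq_two h2 one_le_two le_rfl)

end OrderFourteen

theorem mainTheorem2 {V : Type*} [Fintype V] [DecidableEq V] (v : ℕ) (𝓑 : Finset (Finset V)) :
    (∀ lam : ℕ, 1 ≤ lam → IsSimpleDesign 3 v 4 lam 𝓑 → 16 ≤ v →
      existentialClosureNumber (blockIntersectionGraph 𝓑) = 2) ∧
    (IsSteinerQuadrupleSystem v 𝓑 →
      (existentialClosureNumber (blockIntersectionGraph 𝓑) = 2 ↔ 16 ≤ v)) :=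
  ⟨fun _ hlam h hv => h.existentialClosureNumber_eq_two hlam hv, fun h =>
    ⟨h.le_of_existentialClosureNumber_eq_two,
      fun hv => IsSimpleDesign.existentialClosureNumber_eq_two h le_rfl hv⟩⟩
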